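/- Let $n\ge 1$, $m\ge 0$ and $r\ge 1$ be integers, and let $X=(x_1,\dots,x_n)$ and $Y=(y_1,\dots,y_m)$ be independent commuting indeterminates; write $\bar x_i=x_i^{-1}$ and $\overline X=(\bar x_1,\dots,\bar x_n)$. For a partition $\mu$ with at most $n$ parts, the symplectic Schur polynomial is $$\mathrm{sp}_\mu(X)=\frac{\det_{1\le i,j\le n}\bigl(x_i^{\mu_j+n-j+1}-\bar x_i^{\,\mu_j+n-j+1}\bigr)}{\det_{1\le i,j\le n}\bigl(x_i^{n-j+1}-\bar x_i^{\,n-j+1}\bigr)},$$ and $\mathrm{sp}_\mu(X)=0$ if $\mu$ has more than $n$ parts. For a partition $\lambda$, the orthosymplectic Schur polynomial is $$\mathrm{spo}_\lambda(X/Y)=\sum_{\mu\subseteq\lambda}\mathrm{sp}_\mu(X)\,s_{\lambda'/\mu'}(Y),$$ where $'$ denotes conjugation of partitions and $s_{\lambda'/\mu'}(Y)$ is the skew Schur polynomial, i.e. the generating polynomial of the semistandard tableaux of shape $\lambda'/\mu'$ with entries in $\{1,\dots,m\}$. Put $$P_r(X,\overline X/Y)=\sum_{i=1}^n\bigl(x_i^r+\bar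 x_i^{\,r}\bigr)+(-1)^{r-1}\sum_{j=1}^m y_j^r .$$ For partitions $\mu\subseteq\lambda$, write $\lambda/\mu\in\mathrm{BS}(r)$ if the skew diagram $\lambda/\mu$ is a border strip with $r$ boxes, that is, it has $r$ boxes, is connected and contains no $2\times2$ block of boxes; its height $\mathrm{ht}(\lambda/\mu)$ is one less than its number of non-empty rows. Let $\lambda$ be a partition with at most $n$ parts such that $\lambda_n+1\ge m+r$ (where $\lambda_n=0$ if $\lambda$ has fewer than $n$ parts). Then $$P_r(X,\overline X/Y)\,\mathrm{spo}_\lambda(X/Y)=\sum_{\eta/\lambda\in\mathrm{BS}(r)}(-1)^{\mathrm{ht}(\eta/\lambda)}\,\mathrm{spo}_\eta(X/Y)+\sum_{\lambda/\xi\in\mathrm{BS}(r)}(-1)^{\mathrm{ht}(\lambda/\xi)}\,\mathrm{spo}_\xi(X/Y),$$ where the first sum is over all partitions $\eta\supseteq\lambda$ (of any length) with $\eta/\lambda\in\mathrm{BS}(r)$ and the second over all partitions $\xi\subseteq\lambda$ with $\lambda/\xi\in\mathrm{BS}(r)$. -/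

import Mathlib

namespace OrthoSymplectic

noncomputable section

/-- The set of boxes of the skew diagram `lam / mu` (used for `mu ≤ lam`).
A box `(i, j)` is in row `i` and column `j`, both counted from `0`. -/
def skewCells (lam mu : YoungDiagram) : Finset (ℕ × ℕ) :=
  lam.cells \ mu.cells

/-- Two boxes are adjacent if they share a common side. -/
def Adjacent (a b : ℕ × ℕ) : Prop :=
  (a.1 = b.1 ∧ (a.2 + 1 = b.2 ∨ b.2 + 1 = a.2)) ∨
    (a.2 = b.2 ∧ (a.1 + 1 = b.1 ∨ b.1 + 1 = a.1))

/-- A set of boxes is connected if any two of its boxes are joined by a sequence of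
boxes of the set in which consecutive boxes are adjacent. -/
def IsConnectedCells (S : Finset (ℕ × ℕ)) : Prop :=
  ∀ a ∈ S, ∀ b ∈ S, Relation.ReflTransGen (fun c d => d ∈ S ∧ Adjacent c d) a b

/-- A set of boxes contains a `2 × 2` block. -/
def HasSquare (S : Finset (ℕ × ℕ)) : Prop :=
  ∃ i j : ℕ, (i, j) ∈ S ∧ (i + 1, j) ∈ S ∧ (i, j + 1) ∈ S ∧ (i + 1, j + 1) ∈ S

/-- `lam / mu` is a border strip with `r` boxes. -/
def IsBorderStrip (r : ℕ) (lam mu : YoungDiagram) : Prop :=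
  mu ≤ lam ∧ (skewCells lam mu).card = r ∧
    IsConnectedCells (skewCells lam mu) ∧ ¬ HasSquare (skewCells lam mu)

/-- The height of a border strip: one less than its number of non-empty rows. -/
def height (lam mu : YoungDiagram) : ℕ :=
  ((skewCells lam mu).image Prod.fst).card - 1

theorem finite_le (lam : YoungDiagram) : {mu : YoungDiagram | mu ≤ lam}.Finite := by
  refine Set.Finite.of_finite_image (f := YoungDiagram.cells)
    ((Finset.finite_toSet lam.cells.powerset).subset ?_) ?_
  · rintro _ ⟨mu, hmu, rfl⟩
    simpa using hmu
  · intro a _ b _ h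
    exact YoungDiagram.ext h

theorem mem_bound (eta : YoungDiagram) (c : ℕ × ℕ) (hc : c ∈ eta.cells) :
    c.1 < eta.card ∧ c.2 < eta.card := by
  obtain ⟨i, j⟩ := c
  have hc' : (i, j) ∈ eta := hc
  constructor
  · have h : (Finset.range (i + 1)).image (fun a => (a, j)) ⊆ eta.cells := by
      intro p hp
      simp only [Finset.mem_image, Finset.mem_range] at hp
      obtain ⟨a, ha, rfl⟩ := hp
      exact eta.up_left_mem (by omega) le_rfl hc'
    have h2 := Finset.card_le_card h
    rw [Finset.card_image_of_injective _ (fun a b hab => by simpa using hab)] at h2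
    simpa using h2
  · have h : (Finset.range (j + 1)).image (fun a => (i, a)) ⊆ eta.cells := by
      intro p hp
      simp only [Finset.mem_image, Finset.mem_range] at hp
      obtain ⟨a, ha, rfl⟩ := hp
      exact eta.up_left_mem le_rfl (by omega) hc'
    have h2 := Finset.card_le_card h
    rw [Finset.card_image_of_injective _ (fun a b hab => by simpa using hab)] at h2
    simpa using h2

theorem finite_addStrip (r : ℕ) (lam : YoungDiagram) :
    {eta : YoungDiagram | IsBorderStrip r eta lam}.Finite := by
  refine Set.Finite.of_finite_image (f := YoungDiagram.cells)
    ((Finset.finite_toSet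
      (Finset.range (lam.card + r) ×ˢ Finset.range (lam.card + r)).powerset).subset ?_) ?_
  · rintro _ ⟨eta, ⟨hle, hcard, -⟩, rfl⟩
    have h : eta.card = lam.card + r := by
      have := Finset.card_sdiff_add_card_eq_card (s := lam.cells) (t := eta.cells) hle
      have h3 : (eta.cells \ lam.cells).card = r := hcard
      change eta.cells.card = lam.cells.card + r
      omega
    simp only [Finset.coe_powerset, Set.mem_preimage, Set.mem_powerset_iff, Finset.coe_subset]
    intro c hc
    have := mem_bound eta c hc
    simp only [Finset.mem_product, Finset.mem_range]
    omega
  · intro a _ b _ h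
    exact YoungDiagram.ext h

theorem finite_removeStrip (r : ℕ) (lam : YoungDiagram) :
    {xi : YoungDiagram | IsBorderStrip r lam xi}.Finite :=
  (finite_le lam).subset (fun _ h => h.1)

/-- All partitions `mu ⊆ lam`. -/
def subdiagrams (lam : YoungDiagram) : Finset YoungDiagram :=
  (finite_le lam).toFinset

/-- All partitions `eta` such that `eta / lam` is a border strip with `r` boxes. -/
def addStrip (r : ℕ) (lam : YoungDiagram) : Finset YoungDiagram :=
  (finite_addStrip r lam).toFinset

/-- All partitions `xi` such that `lam / xi` is a border strip with `r` boxes. -/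
def removeStrip (r : ℕ) (lam : YoungDiagram) : Finset YoungDiagram :=
  (finite_removeStrip r lam).toFinset

/-- A filling of the boxes of `lam / mu` with entries in an `m`-element chain is
semistandard: weakly increasing along rows, strictly increasing down columns. -/
def IsSemistandard {m : ℕ} (lam mu : YoungDiagram) (T : skewCells lam mu → Fin m) : Prop :=
  (∀ c d : skewCells lam mu, c.1.1 = d.1.1 → c.1.2 < d.1.2 → T c ≤ T d) ∧
    (∀ c d : skewCells lam mu, c.1.2 = d.1.2 → c.1.1 < d.1.1 → T c < T d)

open Classical in
/-- The skew Schur polynomial `s_{lam/mu}(y_1, …, y_m)` for `mu ≤ lam`, as the sum over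
semistandard tableaux of shape `lam / mu` of the product of the `y_{T(c)}`. -/
def skewSchur {R : Type*} [CommRing R] {m : ℕ} (lam mu : YoungDiagram) (y : Fin m → R) : R :=
  ∑ T : skewCells lam mu → Fin m with IsSemistandard lam mu T, ∏ c, y (T c)

/-- The determinant `A_α = det (x_i ^ α_j - x_i ^ (-α_j))`. -/
def altDet {K : Type*} [Field K] {n : ℕ} (x : Fin n → K) (α : Fin n → ℕ) : K :=
  (Matrix.of fun i j : Fin n => x i ^ α j - (x i)⁻¹ ^ α j).det

/-- The symplectic Schur polynomial `sp_mu(x_1, …, x_n)` by the Weyl character formula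
`A_{mu + δ} / A_δ`, with `δ = (n, n - 1, …, 1)`; as usual it is `0` when `mu` has more
than `n` parts. -/
def symplecticSchur {K : Type*} [Field K] {n : ℕ} (mu : YoungDiagram) (x : Fin n → K) : K :=
  if mu.colLen 0 ≤ n then
    altDet x (fun j => mu.rowLen j + (n - j)) / altDet x (fun j => n - j)
  else 0

/-- The orthosymplectic Schur polynomial
`spo_lam(X/Y) = ∑_{mu ⊆ lam} sp_mu(X) s_{lam'/mu'}(Y)`. -/
def spo {K : Type*} [Field K] {n m : ℕ} (lam : YoungDiagram) (x : Fin n → K) (y : Fin m → K) :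
    K :=
  ∑ mu ∈ subdiagrams lam, symplecticSchur mu x * skewSchur lam.transpose mu.transpose y

/-- The supersymmetric power sum
`P_r(X, X̄/Y) = ∑_i (x_i ^ r + x_i ^ (-r)) + (-1) ^ (r - 1) ∑_j y_j ^ r`, for `r ≥ 1`. -/
def superPowerSum {K : Type*} [Field K] {n m : ℕ} (r : ℕ) (x : Fin n → K) (y : Fin m → K) : K :=
  (∑ i, (x i ^ r + (x i)⁻¹ ^ r)) + (-1) ^ (r - 1) * ∑ j, y j ^ r

/-- The field of rational functions in `x_1, …, x_n, y_1, …, y_m`, which contains the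
Laurent polynomials in the `x_i` and polynomials in the `y_j`. -/
abbrev RatFunField (n m : ℕ) : Type :=
  FractionRing (MvPolynomial (Fin n ⊕ Fin m) ℤ)

/-- The indeterminates `x_1, …, x_n`. -/
def xVar (n m : ℕ) (i : Fin n) : RatFunField n m :=
  algebraMap (MvPolynomial (Fin n ⊕ Fin m) ℤ) (RatFunField n m) (MvPolynomial.X (Sum.inl i))

/-- The indeterminates `y_1, …, y_m`. -/
def yVar (n m : ℕ) (j : Fin m) : RatFunField n m :=
  algebraMap (MvPolynomial (Fin n ⊕ Fin m) ℤ) (RatFunField n m) (MvPolynomial.X (Sum.inr j))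

end

end OrthoSymplectic

namespace OrthoSymplectic

/-! ### Diagrams from row lengths -/

/-! Write `beta lam j` for λ_j - j. Multiplied by the Weyl denominator, every `spo` in the identity
becomes a determinant det (f_i(λ_j - j)) of one common size n + r, whose rows are functions on ℤ.
Before the y-variables enter, the first n functions are b ↦ x_i^(b+n) - x_i^(-(b+n)), truncated to 0
for b ≤ -n, and the last r are delta functions at -n, -n-1, …. The delta rows pad the Weyl numerator
and make it vanish for partitions with more than n parts, as the convention for sp requires
(`sympNum_eq_alternant`). Splitting off one y_k from the skew Schur polynomials removes vertical
strips from λ. By multilinearity in the columns, this amounts to replacing each f_i(b) by f_i(b) +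
y_k f_i(b-1), which is `twist` (`skewSum_eq_alternant`).

The right-hand side is then a sum over columns. Shift the argument of one column by r or -r: either
two columns coincide, or a column is zero, or the arguments are a cyclic rearrangement of those of a
partition differing from λ by a border strip, with sign (-1)^ht. Every border strip arises exactly
once (`sum_alternant_add`, `sum_alternant_sub`). Size n + r leaves room for every strip added below
row n.

For the left-hand side, the bound on λ_n makes the matrix block diagonal, even after any single
shift as far as the determinant can see (`sum_alternant_shift`). In the x-block the arguments are
large enough for truncation to be invisible, so f(b+r) + f(b-r) = (x^r + x^(-r)) f(b), and a trace
argument extracts ∑ (x_i^r + x_i^(-r)). The other block is the unitriangular Toeplitz matrix T =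
(e_{i-j}(Y)). Shifts by -r kill a column, while shifts by r sum to tr(T⁻¹ (e_{i-j+r})) = (-1)^(r-1)
∑ y_j^r, a form of Newton's identities (`trace_adjugate_toeplitz`). -/

theorem rowLen_eq_of_forall {mu : YoungDiagram} {i k : ℕ}
    (h : ∀ j, (i, j) ∈ mu ↔ j < k) : mu.rowLen i = k := by
  have h' : ∀ j, j < mu.rowLen i ↔ j < k := fun j => by
    rw [← YoungDiagram.mem_iff_lt_rowLen, h]
  have h1 := h' k
  have h2 := h' (mu.rowLen i)
  omega

theorem le_iff_rowLen {mu lam : YoungDiagram} :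
    mu ≤ lam ↔ ∀ i, mu.rowLen i ≤ lam.rowLen i := by
  constructor
  · intro h i
    by_contra hc
    have h1 : (i, lam.rowLen i) ∈ mu := YoungDiagram.mem_iff_lt_rowLen.2 (by omega)
    have h2 : (i, lam.rowLen i) ∈ lam := h h1
    exact lt_irrefl _ (YoungDiagram.mem_iff_lt_rowLen.1 h2)
  · rintro h ⟨i, j⟩ hc
    have hc' : (i, j) ∈ mu := hc
    exact YoungDiagram.mem_iff_lt_rowLen.2
      ((YoungDiagram.mem_iff_lt_rowLen.1 hc').trans_le (h i))

theorem ext_rowLen {mu lam : YoungDiagram} (h : ∀ i, mu.rowLen i = lam.rowLen i) : mu = lam :=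
  le_antisymm (le_iff_rowLen.2 fun i => (h i).le) (le_iff_rowLen.2 fun i => (h i).ge)

/-- A weakly decreasing sequence that vanishes from some index on is the sequence of row
lengths of a diagram. -/
theorem exists_rowLen_eq (f : ℕ → ℕ) (hf : ∀ i, f (i + 1) ≤ f i) (N : ℕ) (hN : f N = 0) :
    ∃ mu : YoungDiagram, ∀ i, mu.rowLen i = f i := by
  have hanti : Antitone f := antitone_nat_of_succ_le hf
  refine ⟨⟨(Finset.range N ×ˢ Finset.range (f 0)).filter fun c => c.2 < f c.1, ?_⟩, fun i => ?_⟩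
  · rintro ⟨i, j⟩ ⟨i', j'⟩ hle hc
    obtain ⟨h1, h2⟩ : i' ≤ i ∧ j' ≤ j := hle
    simp only [Finset.coe_filter, Finset.mem_product, Finset.mem_range, Set.mem_ofPred_eq] at hc ⊢
    have := hanti h1
    omega
  · refine rowLen_eq_of_forall fun j => ?_
    change (i, j) ∈ (Finset.range N ×ˢ Finset.range (f 0)).filter (fun c => c.2 < f c.1) ↔ _
    simp only [Finset.mem_filter, Finset.mem_product, Finset.mem_range]
    refine ⟨fun h => h.2, fun h => ⟨⟨?_, ?_⟩, h⟩⟩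
    · by_contra hc
      have := hanti (not_lt.1 hc)
      omega
    · have := hanti (Nat.zero_le i)
      omega

theorem colLen_le_iff {mu : YoungDiagram} {N : ℕ} : mu.colLen 0 ≤ N ↔ mu.rowLen N = 0 := by
  have h := YoungDiagram.mem_iff_lt_colLen (μ := mu) (i := N) (j := 0)
  rw [YoungDiagram.mem_iff_lt_rowLen] at h
  omega

theorem rowLen_eq_zero_of_le {mu : YoungDiagram} {N i : ℕ} (h : mu.rowLen N = 0) (hi : N ≤ i) :
    mu.rowLen i = 0 := by
  have := mu.rowLen_anti N i hi
  omega

theorem mem_skewCells {lam mu : YoungDiagram} {c : ℕ × ℕ} :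
    c ∈ skewCells lam mu ↔ mu.rowLen c.1 ≤ c.2 ∧ c.2 < lam.rowLen c.1 := by
  obtain ⟨i, j⟩ := c
  simp only [skewCells, Finset.mem_sdiff, YoungDiagram.mem_cells, YoungDiagram.mem_iff_lt_rowLen]
  omega

/-! ### Border strips in terms of row lengths -/

/-- `eta / lam` is a border strip with `r` boxes that occupies exactly the rows `p, …, q`. -/
structure StripRows (r p q : ℕ) (eta lam : YoungDiagram) : Prop where
  le : p ≤ q
  above : ∀ i < p, eta.rowLen i = lam.rowLen i
  below : ∀ i, q < i → eta.rowLen i = lam.rowLen i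
  step : ∀ i, p ≤ i → i < q → eta.rowLen (i + 1) = lam.rowLen i + 1
  top_lt : lam.rowLen p < eta.rowLen p
  top : eta.rowLen p + (q - p) = lam.rowLen q + r

namespace StripRows

variable {r p q : ℕ} {eta lam : YoungDiagram}

theorem row_lt (h : StripRows r p q eta lam) {i : ℕ} (h1 : p ≤ i) (h2 : i ≤ q) :
    lam.rowLen i < eta.rowLen i := by
  rcases h1.eq_or_lt with rfl | h1
  · exact h.top_lt
  · obtain ⟨k, rfl⟩ : ∃ k, i = k + 1 := ⟨i - 1, by omega⟩
    have := h.step k (by omega) (by omega)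
    have := lam.rowLen_anti k (k + 1) (by omega)
    omega

theorem row_lt_iff (h : StripRows r p q eta lam) {i : ℕ} :
    lam.rowLen i < eta.rowLen i ↔ p ≤ i ∧ i ≤ q := by
  refine ⟨fun hi => ?_, fun hi => h.row_lt hi.1 hi.2⟩
  by_contra hc
  rcases Nat.lt_or_ge i p with h1 | h1
  · have := h.above i h1
    omega
  · have := h.below i (by omega)
    omega

theorem lam_le (h : StripRows r p q eta lam) : lam ≤ eta := by
  refine le_iff_rowLen.2 fun i => ?_
  rcases Nat.lt_or_ge i p with h1 | h1
  · exact (h.above i h1).ge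
  · rcases Nat.lt_or_ge q i with h2 | h2
    · exact (h.below i h2).ge
    · exact (h.row_lt h1 h2).le

theorem image_fst (h : StripRows r p q eta lam) :
    (skewCells eta lam).image Prod.fst = Finset.Icc p q := by
  ext i
  simp only [Finset.mem_image, Finset.mem_Icc, ← h.row_lt_iff]
  constructor
  · rintro ⟨c, hc, rfl⟩
    rw [mem_skewCells] at hc
    omega
  · intro hi
    exact ⟨(i, lam.rowLen i), mem_skewCells.2 ⟨le_rfl, hi⟩, rfl⟩

theorem height_eq (h : StripRows r p q eta lam) : height eta lam = q - p := by
  have := h.le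
  rw [height, h.image_fst, Nat.card_Icc]
  omega

end StripRows

theorem card_skewCells_row (eta lam : YoungDiagram) (i : ℕ) :
    ((skewCells eta lam).filter fun c => c.1 = i).card = eta.rowLen i - lam.rowLen i := by
  have : (skewCells eta lam).filter (fun c => c.1 = i) =
      {i} ×ˢ Finset.Ico (lam.rowLen i) (eta.rowLen i) := by
    ext ⟨a, b⟩
    simp only [Finset.mem_filter, mem_skewCells, Finset.mem_product, Finset.mem_singleton,
      Finset.mem_Ico]
    constructor
    · rintro ⟨h, rfl⟩
      exact ⟨rfl, h⟩
    · rintro ⟨rfl, h⟩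
      exact ⟨h, rfl⟩
  rw [this]
  simp

/-- The number of boxes of a skew diagram in which consecutive rows `p, …, q` overlap in
exactly one column. -/
theorem card_skewCells_of_step {p q : ℕ} {eta lam : YoungDiagram} (hpq : p ≤ q)
    (himg : (skewCells eta lam).image Prod.fst ⊆ Finset.Icc p q)
    (hstep : ∀ i, p ≤ i → i < q → eta.rowLen (i + 1) = lam.rowLen i + 1)
    (htop : lam.rowLen p < eta.rowLen p) :
    (skewCells eta lam).card + lam.rowLen q = eta.rowLen p + (q - p) := by
  have hcard : (skewCells eta lam).card =
      ∑ i ∈ Finset.Icc p q, (eta.rowLen i - lam.rowLen i) := by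
    rw [Finset.card_eq_sum_card_fiberwise (f := Prod.fst) (t := Finset.Icc p q)]
    · exact Finset.sum_congr rfl fun i _ => card_skewCells_row eta lam i
    · intro c hc
      exact himg (Finset.mem_image_of_mem _ hc)
  have key : ∀ k, p + k ≤ q → ∑ i ∈ Finset.Icc p (p + k), (eta.rowLen i - lam.rowLen i) +
      lam.rowLen (p + k) = eta.rowLen p + k := by
    intro k
    induction k with
    | zero =>
      intro _
      simp
      omega
    | succ k ih =>
      intro hk
      have h1 := ih (by omega)
      have h2 := hstep (p + k) (by omega) (by omega)
      have h3 := lam.rowLen_anti (p + k) (p + k + 1) (by omega)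
      rw [← add_assoc, ← Finset.insert_Icc_right_eq_Icc_add_one (by omega),
        Finset.sum_insert (by simp)]
      omega
  have := key (q - p) (by omega)
  rw [Nat.add_sub_cancel' hpq] at this
  rw [hcard, this]

theorem StripRows.isBorderStrip {r p q : ℕ} {eta lam : YoungDiagram}
    (h : StripRows r p q eta lam) : IsBorderStrip r eta lam := by
  refine ⟨h.lam_le, ?_, ?_, ?_⟩
  · have h1 := card_skewCells_of_step h.le h.image_fst.subset h.step h.top_lt
    have h2 := h.top
    omega
  · set S := skewCells eta lam with hS
    -- Requiring both ends to lie in `S` makes the relation symmetric, so it suffices to join every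
    -- box to the leftmost box of row `p`.
    let R : ℕ × ℕ → ℕ × ℕ → Prop := fun c d => c ∈ S ∧ d ∈ S ∧ Adjacent c d
    have hsymm : ∀ a b, Relation.ReflTransGen R a b → Relation.ReflTransGen R b a := by
      intro a b hab
      have : Std.Symm R := ⟨fun c d => ?_⟩
      · exact Relation.ReflTransGen.stdSymm.symm _ _ hab
      rintro ⟨hc, hd, hcd⟩
      refine ⟨hd, hc, ?_⟩
      rcases hcd with ⟨h1, h2⟩ | ⟨h1, h2⟩
      · exact Or.inl ⟨h1.symm, h2.symm⟩
      · exact Or.inr ⟨h1.symm, h2.symm⟩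
    have hrow : ∀ i k, lam.rowLen i + k < eta.rowLen i →
        Relation.ReflTransGen R (i, lam.rowLen i + k) (i, lam.rowLen i) := by
      intro i k
      induction k with
      | zero => intro _; exact Relation.ReflTransGen.refl
      | succ k ih =>
        intro hk
        refine Relation.ReflTransGen.head ⟨?_, ?_, ?_⟩ (ih (by omega))
        · exact mem_skewCells.2 ⟨by simp, hk⟩
        · exact mem_skewCells.2 ⟨by simp, by simp; omega⟩
        · exact Or.inl ⟨rfl, Or.inr (by simp; omega)⟩
    have hcol : ∀ k, p + k ≤ q →
        Relation.ReflTransGen R (p + k, lam.rowLen (p + k)) (p, lam.rowLen p) := by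
      intro k
      induction k with
      | zero => intro _; exact Relation.ReflTransGen.refl
      | succ k ih =>
        intro hk
        have h2 := h.step (p + k) (by omega) (by omega)
        have h3 := lam.rowLen_anti (p + k) (p + (k + 1)) (by omega)
        have h4 := h.row_lt (i := p + k) (by omega) (by omega)
        have h5 := hrow (p + (k + 1)) (lam.rowLen (p + k) - lam.rowLen (p + (k + 1)))
          (by rw [← add_assoc] at *; omega)
        rw [Nat.add_sub_cancel' h3] at h5
        refine (hsymm _ _ h5).trans (Relation.ReflTransGen.head ⟨?_, ?_, ?_⟩ (ih (by omega)))
        · exact mem_skewCells.2 ⟨h3, by simp only [← add_assoc] at *; omega⟩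
        · exact mem_skewCells.2 ⟨le_rfl, h4⟩
        · exact Or.inr ⟨rfl, Or.inr rfl⟩
    have hbase : ∀ a ∈ S, Relation.ReflTransGen R a (p, lam.rowLen p) := by
      rintro ⟨i, j⟩ ha
      have ha' := mem_skewCells.1 ha
      simp only at ha'
      have hi := h.row_lt_iff.1 (lt_of_le_of_lt ha'.1 ha'.2)
      have h1 := hrow i (j - lam.rowLen i) (by omega)
      rw [Nat.add_sub_cancel' ha'.1] at h1
      have h2 := hcol (i - p) (by omega)
      rw [Nat.add_sub_cancel' hi.1] at h2
      exact h1.trans h2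
    intro a ha b hb
    have hR : R ≤ fun c d => d ∈ S ∧ Adjacent c d := fun c d hcd => hcd.2
    exact Relation.ReflTransGen.mono hR _ _ ((hbase a ha).trans (hsymm _ _ (hbase b hb)))
  · rintro ⟨i, j, h1, -, -, h4⟩
    have h1 := mem_skewCells.1 h1
    have h4 := mem_skewCells.1 h4
    simp only at h1 h4
    have h5 := h.row_lt_iff.1 (lt_of_le_of_lt h1.1 h1.2)
    have h6 := h.row_lt_iff.1 (lt_of_le_of_lt h4.1 h4.2)
    have := h.step i h5.1 (by omega)
    omega

/-- Consecutive rows overlap in exactly one column: two columns would give a 2 × 2 block, and none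
would disconnect the rows above from those below. The box count then telescopes to the `top`
equation. -/
theorem IsBorderStrip.exists_stripRows {r : ℕ} (hr : 1 ≤ r) {eta lam : YoungDiagram}
    (h : IsBorderStrip r eta lam) : ∃ p q, StripRows r p q eta lam := by
  obtain ⟨hle, hcard, hconn, hsq⟩ := h
  set S := skewCells eta lam with hS
  have hle' := le_iff_rowLen.1 hle
  have hne : (S.image Prod.fst).Nonempty := by
    rw [Finset.image_nonempty, ← Finset.card_pos]
    omega
  have hmem : ∀ i, i ∈ S.image Prod.fst ↔ lam.rowLen i < eta.rowLen i := by
    intro i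
    simp only [Finset.mem_image]
    constructor
    · rintro ⟨c, hc, rfl⟩
      have := mem_skewCells.1 hc
      omega
    · intro hi
      exact ⟨(i, lam.rowLen i), mem_skewCells.2 ⟨le_rfl, hi⟩, rfl⟩
  set p := (S.image Prod.fst).min' hne with hp
  set q := (S.image Prod.fst).max' hne with hq
  have hpm : p ∈ S.image Prod.fst := Finset.min'_mem _ hne
  have hqm : q ∈ S.image Prod.fst := Finset.max'_mem _ hne
  have hpq : p ≤ q := Finset.min'_le _ _ hqm
  have hstep : ∀ i, p ≤ i → i < q → eta.rowLen (i + 1) = lam.rowLen i + 1 := by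
    intro i h1 h2
    apply le_antisymm
    · by_contra hc
      have h3 := lam.rowLen_anti i (i + 1) (by omega)
      have h4 := eta.rowLen_anti i (i + 1) (by omega)
      refine hsq ⟨i, lam.rowLen i, ?_, ?_, ?_, ?_⟩ <;> refine mem_skewCells.2 ⟨?_, ?_⟩ <;>
        simp only <;> omega
    · by_contra hc
      obtain ⟨a, ha, hap⟩ := Finset.mem_image.1 hpm
      obtain ⟨b, hb, hbq⟩ := Finset.mem_image.1 hqm
      -- Without overlap no adjacency crosses from row `i` to row `i + 1`, so a path from row `p`
      -- never leaves the rows up to `i` and cannot reach row `q`.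
      have key : ∀ d, Relation.ReflTransGen (fun c d => d ∈ S ∧ Adjacent c d) a d →
          d ∈ S ∧ d.1 ≤ i := by
        intro d hd
        induction hd with
        | refl => exact ⟨ha, by omega⟩
        | tail _ hcd ih =>
          rename_i c d _
          obtain ⟨hd, hadj⟩ := hcd
          refine ⟨hd, ?_⟩
          rcases hadj with ⟨h3, -⟩ | ⟨h3, h4⟩
          · omega
          · by_contra hdi
            have hc1 : c.1 = i := by omega
            have hd1 : d.1 = i + 1 := by omega
            have h5 := (mem_skewCells.1 ih.1).1
            have h6 := (mem_skewCells.1 hd).2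
            rw [hc1] at h5
            rw [hd1] at h6
            omega
      have := (key b (hconn a ha b hb)).2
      omega
  have htop := (hmem p).1 hpm
  have hcc := card_skewCells_of_step hpq
    (fun i hi => Finset.mem_Icc.2 ⟨Finset.min'_le _ _ hi, Finset.le_max' _ _ hi⟩) hstep htop
  refine ⟨p, q, hpq, fun i hi => ?_, fun i hi => ?_, hstep, htop, ?_⟩
  · by_contra hc
    have h1 := hle' i
    have h2 := Finset.min'_le _ _ ((hmem i).2 (by omega))
    omega
  · by_contra hc
    have h1 := hle' i
    have h2 := Finset.le_max' _ _ ((hmem i).2 (by omega))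
    omega
  · rw [← hS] at hcc
    omega

noncomputable section

/-! ### Alternants and border strips -/

/-- The sequence `lam_j - j`. -/
def beta (lam : YoungDiagram) (j : ℕ) : ℤ := (lam.rowLen j : ℤ) - j

theorem neg_lt_beta (lam : YoungDiagram) {N j : ℕ} (hj : j < N) : -(N : ℤ) < beta lam j := by
  simp only [beta]
  omega

/-- The alternant `det (f_i(a_j))` of a family of functions on the integers. -/
def alternant {K : Type*} [CommRing K] {N : ℕ} (f : Fin N → ℤ → K) (a : Fin N → ℤ) : K :=
  (Matrix.of fun i j => f i (a j)).det

section Alternant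

variable {K : Type*} [CommRing K] {N : ℕ} (f : Fin N → ℤ → K)

theorem alternant_eq_zero_of_eq {a : Fin N → ℤ} {i j : Fin N} (hij : i ≠ j) (h : a i = a j) :
    alternant f a = 0 :=
  Matrix.det_zero_of_column_eq hij fun k => by simp [h]

theorem alternant_eq_zero_of_col {a : Fin N → ℤ} (j : Fin N) (h : ∀ i, f i (a j) = 0) :
    alternant f a = 0 :=
  Matrix.det_eq_zero_of_column_eq_zero j h

theorem alternant_comp_perm (a : Fin N → ℤ) (σ : Equiv.Perm (Fin N)) :
    alternant f (a ∘ σ) = (Equiv.Perm.sign σ : ℤ) * alternant f a := by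
  rw [alternant, alternant, ← Matrix.det_permute']
  rfl

/-- Adding `r` to the `q`-th entry of `beta lam` gives `beta eta` up to a cyclic permutation
of the entries. -/
theorem StripRows.update_comp_cycleIcc {r p q : ℕ} {eta lam : YoungDiagram}
    (h : StripRows r p q eta lam) (hq : q < N) (hp : p < N) (j : Fin N) :
    Function.update (fun j : Fin N => beta lam j) ⟨q, hq⟩ (beta lam q + r) j =
      beta eta (Fin.cycleIcc ⟨p, hp⟩ ⟨q, hq⟩ j) := by
  have : NeZero N := ⟨by omega⟩
  have hpq := h.le
  have htop := h.top
  rcases lt_trichotomy j ⟨q, hq⟩ with hj | rfl | hj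
  · have hjq : (j : ℕ) < q := hj
    rw [Function.update_of_ne hj.ne]
    rcases Nat.lt_or_ge j p with hjp | hjp
    · rw [Fin.cycleIcc_of_lt (by exact hjp)]
      simp [beta, h.above j hjp]
    · rw [Fin.cycleIcc_of_ge_of_lt (by exact hjp) hj, Fin.val_add_one_of_lt' (by omega)]
      have := h.step j hjp hjq
      simp only [beta]
      omega
  · rw [Function.update_self, Fin.cycleIcc_of_last (by exact hpq)]
    simp only [beta]
    omega
  · rw [Function.update_of_ne hj.ne', Fin.cycleIcc_of_gt hj]
    simp [beta, h.below j hj]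

theorem StripRows.alternant_add {r p q : ℕ} {eta lam : YoungDiagram}
    (h : StripRows r p q eta lam) (hq : q < N) :
    alternant f (Function.update (fun j : Fin N => beta lam j) ⟨q, hq⟩ (beta lam q + r)) =
      (-1) ^ height eta lam * alternant f (fun j => beta eta j) := by
  have hp : p < N := h.le.trans_lt hq
  have h1 : Function.update (fun j : Fin N => beta lam j) ⟨q, hq⟩ (beta lam q + r) =
      (fun j : Fin N => beta eta j) ∘ Fin.cycleIcc ⟨p, hp⟩ ⟨q, hq⟩ :=
    funext fun j => h.update_comp_cycleIcc hq hp j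
  rw [h1, alternant_comp_perm, Fin.sign_cycleIcc_of_le (by exact h.le), h.height_eq]
  simp

/-- The same cyclic permutation as for addition, read backwards; its sign is its own inverse. -/
theorem StripRows.alternant_sub {r p q : ℕ} {eta lam : YoungDiagram}
    (h : StripRows r p q eta lam) (hq : q < N) (hp : p < N) :
    alternant f (Function.update (fun j : Fin N => beta eta j) ⟨p, hp⟩ (beta eta p - r)) =
      (-1) ^ height eta lam * alternant f (fun j => beta lam j) := by
  have : NeZero N := ⟨by omega⟩
  have hpq : (⟨p, hp⟩ : Fin N) ≤ ⟨q, hq⟩ := h.le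
  set σ := Fin.cycleIcc (⟨p, hp⟩ : Fin N) ⟨q, hq⟩ with hσ
  have hσq : σ ⟨q, hq⟩ = ⟨p, hp⟩ := Fin.cycleIcc_of_last hpq
  have hq' := h.update_comp_cycleIcc hq hp ⟨q, hq⟩
  rw [Function.update_self, ← hσ, hσq] at hq'
  have h1 : (Function.update (fun j : Fin N => beta eta j) ⟨p, hp⟩ (beta eta p - r)) ∘ σ =
      fun j : Fin N => beta lam j := by
    funext j
    by_cases hj : j = ⟨q, hq⟩
    · subst hj
      rw [Function.comp_apply, hσq, Function.update_self]
      simp only at hq' ⊢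
      omega
    · have hne : σ j ≠ ⟨p, hp⟩ := fun hc => hj (σ.injective (hc.trans hσq.symm))
      rw [Function.comp_apply, Function.update_of_ne hne, ← h.update_comp_cycleIcc hq hp j,
        Function.update_of_ne hj]
  have h2 := alternant_comp_perm f
    (Function.update (fun j : Fin N => beta eta j) ⟨p, hp⟩ (beta eta p - r)) σ
  rw [h1, Fin.sign_cycleIcc_of_le hpq] at h2
  rw [h2, h.height_eq, ← mul_assoc]
  simp [← mul_pow]

end Alternant

/-! ### Border strips with a prescribed end row -/

/-- Raise the `q`-th entry of the strictly decreasing sequence `beta lam` by `r`. If the new value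
is not already taken, sorting it into place gives `beta eta`, and `p` is the position where it
lands. -/
theorem exists_stripRows_of_add {r q : ℕ} (hr : 1 ≤ r) (lam : YoungDiagram)
    (h : ∀ i < q, beta lam i ≠ beta lam q + r) : ∃ p eta, StripRows r p q eta lam := by
  classical
  have hex : ∃ i, beta lam i < beta lam q + r := ⟨q, by omega⟩
  set p := Nat.find hex with hp
  have hps : beta lam p < beta lam q + r := Nat.find_spec hex
  have hpq : p ≤ q := Nat.find_min' hex (by omega)
  have hlt : ∀ i < p, beta lam q + r < beta lam i := fun i hi => by
    have h1 := Nat.find_min hex hi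
    have h2 := h i (by omega)
    omega
  clear_value p
  simp only [beta] at hps hlt
  -- Rows of the sorted sequence: the raised entry moves up `q - p` places and loses that many
  -- boxes, while each entry it passes moves down one place and gains a box.
  let g : ℕ → ℕ := fun i =>
    if i < p then lam.rowLen i else if i = p then lam.rowLen q + r - (q - p)
    else if i ≤ q then lam.rowLen (i - 1) + 1 else lam.rowLen i
  have hg : ∀ i, g (i + 1) ≤ g i := by
    intro i
    have h0 := lam.rowLen_anti i (i + 1) (by omega)
    have h0' := lam.rowLen_anti (i - 1) i (by omega)
    rcases lt_trichotomy i p with hi | hi | hi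
    · have h1 := hlt i hi
      by_cases h2 : i + 1 = p
      · simp only [g, if_pos hi, if_neg (show ¬ i + 1 < p by omega), if_pos h2]
        omega
      · simp only [g, if_pos hi, if_pos (show i + 1 < p by omega)]
        omega
    · subst hi
      by_cases h2 : i = q
      · simp only [g]
        split_ifs <;> omega
      · simp only [g, if_neg (show ¬ i + 1 < i by omega), if_neg (show ¬ i + 1 = i by omega),
          if_pos (show i + 1 ≤ q by omega), lt_irrefl, if_false, if_true, Nat.add_sub_cancel]
        omega
    · simp only [g, if_neg (show ¬ i < p by omega), if_neg (show ¬ i = p by omega),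
        if_neg (show ¬ i + 1 < p by omega), if_neg (show ¬ i + 1 = p by omega),
        Nat.add_sub_cancel]
      split_ifs <;> omega
  have hN : g (lam.colLen 0 + q + 1) = 0 := by
    have : lam.rowLen (lam.colLen 0 + q + 1) = 0 :=
      rowLen_eq_zero_of_le (colLen_le_iff.1 le_rfl) (by omega)
    simp only [g]
    split_ifs <;> omega
  obtain ⟨eta, heta⟩ := exists_rowLen_eq g hg _ hN
  refine ⟨p, eta, hpq, fun i hi => ?_, fun i hi => ?_, fun i h1 h2 => ?_, ?_, ?_⟩ <;>
    simp only [heta, g]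
  · rw [if_pos hi]
  · rw [if_neg (by omega), if_neg (by omega), if_neg (by omega)]
  · rw [if_neg (by omega), if_neg (by omega), if_pos (by omega), Nat.add_sub_cancel]
  · simp only [lt_irrefl, if_false, if_true]
    omega
  · simp only [lt_irrefl, if_false, if_true]
    omega

/-- The reverse sorting: the lowered entry moves down to position `q`. The bound `h0` keeps it above
`beta eta N = -N`, so it stops before row `N` with a nonnegative row length. -/
theorem exists_stripRows_of_sub {r p N : ℕ} (hr : 1 ≤ r) (eta : YoungDiagram) (hpN : p < N)
    (hN : eta.rowLen N = 0) (h0 : -(N : ℤ) < beta eta p - r)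
    (h : ∀ i, p < i → i < N → beta eta i ≠ beta eta p - r) :
    ∃ q lam, q < N ∧ StripRows r p q eta lam := by
  classical
  have hex : ∃ i, p ≤ i ∧ beta eta (i + 1) < beta eta p - r := by
    refine ⟨N - 1, by omega, ?_⟩
    rw [Nat.sub_add_cancel (by omega), beta, hN]
    simpa using h0
  set q := Nat.find hex with hq
  obtain ⟨hpq, hqs⟩ : p ≤ q ∧ beta eta (q + 1) < beta eta p - r := Nat.find_spec hex
  have hqN : q < N := by
    have : q ≤ N - 1 := Nat.find_min' hex ⟨by omega, by
      rw [Nat.sub_add_cancel (by omega), beta, hN]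
      simpa using h0⟩
    omega
  have hlt : ∀ i, p < i → i ≤ q → beta eta p - r < beta eta i := fun i hi hi2 => by
    have h1 := Nat.find_min hex (m := i - 1) (by omega)
    rw [Nat.sub_add_cancel (by omega)] at h1
    have h2 := h i hi (by omega)
    have h3 : ¬ beta eta i < beta eta p - r := fun hc => h1 ⟨by omega, hc⟩
    omega
  clear_value q
  simp only [beta] at hqs hlt h0
  push_cast at hqs
  let g : ℕ → ℕ := fun i =>
    if i < p then eta.rowLen i else if i < q then eta.rowLen (i + 1) - 1
    else if i = q then eta.rowLen p + (q - p) - r else eta.rowLen i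
  have hg : ∀ i, g (i + 1) ≤ g i := by
    intro i
    have e0 := eta.rowLen_anti i (i + 1) (by omega)
    have e1 := eta.rowLen_anti (i + 1) (i + 1 + 1) (by omega)
    rcases Nat.lt_or_ge i p with hi | hi
    · have e2 := eta.rowLen_anti i p (by omega)
      simp only [g, if_pos hi]
      by_cases hi' : i + 1 < p
      · rw [if_pos hi']
        omega
      · rw [if_neg hi']
        split_ifs with h1 h2
        · omega
        · have h3 : p = q := by omega
          omega
        · omega
    · rcases lt_trichotomy i q with hi2 | hi2 | hi2
      · have h3 := hlt (i + 1) (by omega) (by omega)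
        simp only [g, if_neg (show ¬ i < p by omega), if_pos hi2,
          if_neg (show ¬ i + 1 < p by omega)]
        split_ifs with h1 h2
        · omega
        · omega
        · omega
      · subst hi2
        simp only [g, if_neg (show ¬ i < p by omega), if_neg (show ¬ i + 1 < p by omega),
          if_neg (show ¬ i + 1 < i by omega), if_neg (show ¬ i + 1 = i by omega),
          lt_irrefl, if_false, if_true]
        omega
      · simp only [g, if_neg (show ¬ i < p by omega), if_neg (show ¬ i + 1 < p by omega),
          if_neg (show ¬ i < q by omega), if_neg (show ¬ i + 1 < q by omega),
          if_neg (show ¬ i = q by omega), if_neg (show ¬ i + 1 = q by omega)]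
        omega
  have hN' : g N = 0 := by
    simp only [g, if_neg (show ¬ N < p by omega), if_neg (show ¬ N < q by omega),
      if_neg (show ¬ N = q by omega), hN]
  obtain ⟨lam, hlam⟩ := exists_rowLen_eq g hg _ hN'
  have hge : ∀ i, p ≤ i → i < q → 1 ≤ eta.rowLen (i + 1) := fun i h1 h2 => by
    have h4 := hlt (i + 1) (by omega) (by omega)
    have h5 := eta.rowLen_anti (i + 1) q (by omega)
    have h6 := hlt q (by omega) le_rfl
    omega
  refine ⟨q, lam, hqN, hpq, fun i hi => ?_, fun i hi => ?_, fun i h1 h2 => ?_, ?_, ?_⟩ <;>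
    simp only [hlam, g]
  · rw [if_pos hi]
  · rw [if_neg (by omega), if_neg (by omega), if_neg (by omega)]
  · have := hge i h1 h2
    rw [if_neg (by omega), if_pos (by omega)]
    omega
  · rw [if_neg (lt_irrefl p)]
    split_ifs with h1 h2
    · have h3 := hlt (p + 1) (by omega) (by omega)
      have h4 := hge p le_rfl h1
      have h5 := eta.rowLen_anti p (p + 1) (by omega)
      omega
    · omega
    · omega
  · simp only [if_neg (show ¬ q < p by omega), lt_irrefl, if_false, if_true]
    omega

/-- Both strips have λ_q - q + r as their value of `beta` in the first row. If `p < p'`, that value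
would exceed `beta lam p`, the value of `beta eta'` at `p`, although `beta eta'` decreases. -/
theorem StripRows.first_row_le {r p p' q : ℕ} {eta eta' lam : YoungDiagram}
    (h : StripRows r p q eta lam) (h' : StripRows r p' q eta' lam) : p' ≤ p := by
  by_contra hc
  have h1 := h'.above p (by omega)
  have h2 := eta'.rowLen_anti p p' (by omega)
  have h3 := h.top_lt
  have h4 := h.top
  have h5 := h'.top
  have h6 := h'.le
  omega

theorem StripRows.last_row_le {r p q q' : ℕ} {eta lam lam' : YoungDiagram}
    (h : StripRows r p q eta lam) (h' : StripRows r p q' eta lam') : q' ≤ q := by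
  by_contra hc
  have h0 := h.le
  have h1 := h'.step q (by omega) (by omega)
  have h2 := h.below (q + 1) (by omega)
  have h3 := lam'.rowLen_anti q q' (by omega)
  have h4 := lam.rowLen_anti q (q + 1) (by omega)
  have h5 := h.top
  have h6 := h'.top
  omega

/-- Adding a border strip is determined by its last row. -/
theorem StripRows.unique_add {r p p' q : ℕ} {eta eta' lam : YoungDiagram}
    (h : StripRows r p q eta lam) (h' : StripRows r p' q eta' lam) : eta = eta' := by
  obtain rfl : p = p' := le_antisymm (h'.first_row_le h) (h.first_row_le h')
  refine ext_rowLen fun i => ?_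
  rcases lt_trichotomy i p with hi | rfl | hi
  · rw [h.above i hi, h'.above i hi]
  · have := h.top
    have := h'.top
    omega
  · rcases Nat.lt_or_ge q i with hi2 | hi2
    · rw [h.below i hi2, h'.below i hi2]
    · have h1 := h.step (i - 1) (by omega) (by omega)
      have h2 := h'.step (i - 1) (by omega) (by omega)
      rw [Nat.sub_add_cancel (by omega)] at h1 h2
      omega

/-- Removing a border strip is determined by its first row. -/
theorem StripRows.unique_sub {r p q q' : ℕ} {eta lam lam' : YoungDiagram}
    (h : StripRows r p q eta lam) (h' : StripRows r p q' eta lam') : lam = lam' := by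
  obtain rfl : q = q' := le_antisymm (h'.last_row_le h) (h.last_row_le h')
  refine ext_rowLen fun i => ?_
  rcases lt_trichotomy i q with hi | rfl | hi
  · rcases Nat.lt_or_ge i p with hi2 | hi2
    · rw [← h.above i hi2, h'.above i hi2]
    · have h1 := h.step i (by omega) (by omega)
      have h2 := h'.step i (by omega) (by omega)
      omega
  · have := h.top
    have := h'.top
    omega
  · rw [← h.below i hi, h'.below i hi]

/-! ### Column shifts enumerate border strips -/

section Sum

variable {K : Type*} [CommRing K] {N : ℕ} (f : Fin N → ℤ → K)

/-- A strip with `r` boxes added to a diagram with at most `L` rows ends in the first `L + r`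
rows. -/
theorem StripRows.last_row_lt {r p q L : ℕ} {eta lam : YoungDiagram} (h : StripRows r p q eta lam)
    (hL : lam.rowLen L = 0) : q < L + r := by
  by_contra hc
  have h1 := rowLen_eq_zero_of_le hL (i := q) (by omega)
  have h2 := h.top
  have h3 := h.top_lt
  have h4 := h.le
  have h5 := h.above (p - 1) (by omega)
  have h6 := rowLen_eq_zero_of_le hL (i := p - 1) (by omega)
  have h7 := eta.rowLen_anti (p - 1) p (by omega)
  omega

theorem StripRows.rowLen_eq_zero {r p q N : ℕ} {eta lam : YoungDiagram}
    (h : StripRows r p q eta lam) (hN : lam.rowLen N = 0) (hq : q < N) : eta.rowLen N = 0 := by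
  rw [h.below N hq, hN]

theorem mem_addStrip {r : ℕ} {eta lam : YoungDiagram} :
    eta ∈ addStrip r lam ↔ IsBorderStrip r eta lam := by
  simp [addStrip]

theorem mem_removeStrip {r : ℕ} {xi lam : YoungDiagram} :
    xi ∈ removeStrip r lam ↔ IsBorderStrip r lam xi := by
  simp [removeStrip]

/-- Adding `r` to each entry of `beta lam` in turn enumerates, up to sign, the diagrams obtained
by adding a border strip with `r` boxes. -/
theorem sum_alternant_add {r L : ℕ} (hr : 1 ≤ r) (lam : YoungDiagram) (hL : lam.rowLen L = 0)
    (hN : L + r ≤ N) :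
    ∑ q : Fin N, alternant f (Function.update (fun j : Fin N => beta lam j) q (beta lam q + r)) =
      ∑ eta ∈ addStrip r lam, (-1) ^ height eta lam * alternant f (fun j => beta eta j) := by
  classical
  have hex : ∀ eta ∈ addStrip r lam, ∃ q : Fin N, ∃ p : ℕ, StripRows r p q eta lam := by
    intro eta heta
    obtain ⟨p, q, h⟩ := (mem_addStrip.1 heta).exists_stripRows hr
    exact ⟨⟨q, (h.last_row_lt hL).trans_le hN⟩, p, h⟩
  have : NeZero N := ⟨by omega⟩
  let e : YoungDiagram → Fin N := fun eta =>
    if h : eta ∈ addStrip r lam then (hex eta h).choose else 0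
  have he : ∀ eta ∈ addStrip r lam, ∃ p : ℕ, StripRows r p (e eta) eta lam := by
    intro eta heta
    simp only [e, dif_pos heta]
    exact (hex eta heta).choose_spec
  symm
  refine Finset.sum_of_injOn e ?_ (by simp) ?_ ?_
  · intro eta h1 eta' h2 h12
    obtain ⟨p, hp⟩ := he eta h1
    obtain ⟨p', hp'⟩ := he eta' h2
    rw [← h12] at hp'
    exact hp.unique_add hp'
  · intro q _ hq
    by_cases hc : ∀ i < (q : ℕ), beta lam i ≠ beta lam q + r
    · obtain ⟨p, eta, h⟩ := exists_stripRows_of_add hr lam hc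
      have hmem := mem_addStrip.2 h.isBorderStrip
      refine absurd ⟨eta, hmem, ?_⟩ hq
      obtain ⟨p', hp'⟩ := he eta hmem
      have h1 := h.image_fst
      rw [hp'.image_fst] at h1
      have h2 : (q : ℕ) ∈ Finset.Icc p' (e eta : ℕ) := by
        rw [h1]
        simp [h.le]
      have h3 : (e eta : ℕ) ∈ Finset.Icc p (q : ℕ) := by
        rw [← h1]
        simp [hp'.le]
      rw [Finset.mem_Icc] at h2 h3
      exact Fin.ext (le_antisymm h3.2 h2.2)
    -- The raised value is already taken by an earlier entry, so two columns agree.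
    · push Not at hc
      obtain ⟨i, hi, hiq⟩ := hc
      have hne : (⟨i, by omega⟩ : Fin N) ≠ q := fun h => by
        rw [← h] at hi
        exact lt_irrefl _ hi
      refine alternant_eq_zero_of_eq f hne ?_
      rw [Function.update_of_ne hne, Function.update_self]
      exact hiq
  · intro eta heta
    obtain ⟨p, hp⟩ := he eta heta
    exact (hp.alternant_add f (e eta).2).symm

/-- Subtracting `r` from each entry of `beta lam` in turn enumerates, up to sign, the diagrams
obtained by removing a border strip with `r` boxes. -/
theorem sum_alternant_sub {r : ℕ} (hr : 1 ≤ r) (lam : YoungDiagram) (hN : lam.rowLen N = 0)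
    (hf : ∀ i, ∀ b ≤ -(N : ℤ), f i b = 0) :
    ∑ p : Fin N, alternant f (Function.update (fun j : Fin N => beta lam j) p (beta lam p - r)) =
      ∑ xi ∈ removeStrip r lam, (-1) ^ height lam xi * alternant f (fun j => beta xi j) := by
  classical
  have hlt : ∀ {p q : ℕ} {xi : YoungDiagram}, StripRows r p q lam xi → q < N := by
    intro p q xi h
    by_contra hc
    have h1 := h.row_lt h.le le_rfl
    have h2 := rowLen_eq_zero_of_le hN (i := q) (by omega)
    omega
  have hex : ∀ xi ∈ removeStrip r lam, ∃ p : Fin N, ∃ q : ℕ, StripRows r p q lam xi := by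
    intro xi hxi
    obtain ⟨p, q, h⟩ := (mem_removeStrip.1 hxi).exists_stripRows hr
    exact ⟨⟨p, h.le.trans_lt (hlt h)⟩, q, h⟩
  rcases Nat.eq_zero_or_pos N with rfl | hpos
  · rw [Finset.univ_eq_empty, Finset.sum_empty, Finset.sum_eq_zero]
    intro xi hxi
    exact (hex xi hxi).choose.elim0
  have : NeZero N := ⟨by omega⟩
  let e : YoungDiagram → Fin N := fun xi =>
    if h : xi ∈ removeStrip r lam then (hex xi h).choose else 0
  have he : ∀ xi ∈ removeStrip r lam, ∃ q : ℕ, StripRows r (e xi) q lam xi := by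
    intro xi hxi
    simp only [e, dif_pos hxi]
    exact (hex xi hxi).choose_spec
  symm
  refine Finset.sum_of_injOn e ?_ (by simp) ?_ ?_
  · intro xi h1 xi' h2 h12
    obtain ⟨q, hq⟩ := he xi h1
    obtain ⟨q', hq'⟩ := he xi' h2
    rw [← h12] at hq'
    exact hq.unique_sub hq'
  · intro p _ hp
    by_cases hc : ∀ i, (p : ℕ) < i → i < N → beta lam i ≠ beta lam p - r
    · by_cases h0 : -(N : ℤ) < beta lam p - r
      · obtain ⟨q, xi, -, h⟩ := exists_stripRows_of_sub hr lam p.2 hN h0 hc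
        have hmem := mem_removeStrip.2 h.isBorderStrip
        refine absurd ⟨xi, hmem, ?_⟩ hp
        obtain ⟨q', hq'⟩ := he xi hmem
        have h1 := h.image_fst
        rw [hq'.image_fst] at h1
        have h2 : (p : ℕ) ∈ Finset.Icc (e xi : ℕ) q' := by
          rw [h1]
          simp [h.le]
        have h3 : (e xi : ℕ) ∈ Finset.Icc (p : ℕ) q := by
          rw [← h1]
          simp [hq'.le]
        rw [Finset.mem_Icc] at h2 h3
        exact Fin.ext (le_antisymm h2.1 h3.1)
      -- The lowered argument is at most `-N`, where all the functions vanish; no partition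
      -- corresponds to this shift.
      · refine alternant_eq_zero_of_col f p fun i => ?_
        rw [Function.update_self]
        exact hf i _ (by omega)
    · push Not at hc
      obtain ⟨i, hi, hiN, hip⟩ := hc
      have hne : (⟨i, hiN⟩ : Fin N) ≠ p := fun h => by
        rw [← h] at hi
        exact lt_irrefl _ hi
      refine alternant_eq_zero_of_eq f hne ?_
      rw [Function.update_of_ne hne, Function.update_self]
      exact hip
  · intro xi hxi
    obtain ⟨q, hq⟩ := he xi hxi
    exact (hq.alternant_sub f (hlt hq) (e xi).2).symm

end Sum

/-! ### Branching of skew Schur polynomials -/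

theorem mem_subdiagrams {mu lam : YoungDiagram} : mu ∈ subdiagrams lam ↔ mu ≤ lam := by
  simp [subdiagrams]

theorem mem_skewCells_iff {lam mu : YoungDiagram} {c : ℕ × ℕ} :
    c ∈ skewCells lam mu ↔ c ∈ lam ∧ c ∉ mu := by
  simp [skewCells]

section Branching

variable {m : ℕ} {L M V : YoungDiagram}

/-- Go through the corner `(i, j')`, which lies in the skew shape. Monotonicity in both directions
is what makes the boxes with non-maximal entries, together with `M`, a Young diagram. -/
theorem IsSemistandard.mono {T : skewCells L M → Fin m} (hT : IsSemistandard L M T)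
    {c d : skewCells L M} (hcd : c.1 ≤ d.1) : T c ≤ T d := by
  obtain ⟨⟨i, j⟩, hc⟩ := c
  obtain ⟨⟨i', j'⟩, hd⟩ := d
  obtain ⟨h1, h2⟩ : i ≤ i' ∧ j ≤ j' := hcd
  have hc' := mem_skewCells_iff.1 hc
  have hd' := mem_skewCells_iff.1 hd
  have he : (i, j') ∈ skewCells L M :=
    mem_skewCells_iff.2 ⟨L.up_left_mem h1 le_rfl hd'.1, fun h => hc'.2 (M.up_left_mem le_rfl h2 h)⟩
  have s1 : T ⟨(i, j), hc⟩ ≤ T ⟨(i, j'), he⟩ := by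
    rcases h2.eq_or_lt with rfl | h2
    · exact le_rfl
    · exact hT.1 _ _ rfl h2
  have s2 : T ⟨(i, j'), he⟩ ≤ T ⟨(i', j'), hd⟩ := by
    rcases h1.eq_or_lt with rfl | h1
    · exact le_rfl
    · exact (hT.2 ⟨(i, j'), he⟩ ⟨(i', j'), hd⟩ rfl h1).le
  exact s1.trans s2

/-- `V` is the shape formed by `M` and the boxes of `T` with entry other than the largest one. -/
def IsInner (T : skewCells L M → Fin (m + 1)) (V : YoungDiagram) : Prop :=
  ∀ c : skewCells L M, T c ≠ Fin.last m ↔ c.1 ∈ V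

open Classical in
/-- The diagrams `V` with `M ≤ V ≤ L` such that `L / V` is a horizontal strip. -/
def horizontalRemovals (L M : YoungDiagram) : Finset YoungDiagram :=
  (subdiagrams L).filter fun V => M ≤ V ∧ ∀ j, L.colLen j ≤ V.colLen j + 1

theorem mem_horizontalRemovals :
    V ∈ horizontalRemovals L M ↔ V ≤ L ∧ M ≤ V ∧ ∀ j, L.colLen j ≤ V.colLen j + 1 := by
  simp [horizontalRemovals, mem_subdiagrams]

theorem IsInner.unique {V' : YoungDiagram} {T : skewCells L M → Fin (m + 1)}
    (hV : IsInner T V) (hV' : IsInner T V') (h : V ∈ horizontalRemovals L M)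
    (h' : V' ∈ horizontalRemovals L M) : V = V' := by
  rw [mem_horizontalRemovals] at h h'
  refine SetLike.ext fun c => ?_
  by_cases hL : c ∈ L
  · by_cases hM : c ∈ M
    · exact ⟨fun _ => h'.2.1 hM, fun _ => h.2.1 hM⟩
    · rw [← hV ⟨c, mem_skewCells_iff.2 ⟨hL, hM⟩⟩, ← hV' ⟨c, mem_skewCells_iff.2 ⟨hL, hM⟩⟩]
  · exact ⟨fun hc => absurd (h.1 hc) hL, fun hc => absurd (h'.1 hc) hL⟩

theorem IsSemistandard.exists_isInner (hML : M ≤ L) {T : skewCells L M → Fin (m + 1)}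
    (hT : IsSemistandard L M T) : ∃ V ∈ horizontalRemovals L M, IsInner T V := by
  classical
  let C : Finset (ℕ × ℕ) :=
    L.cells.filter fun c => ∀ h : c ∈ skewCells L M, T ⟨c, h⟩ ≠ Fin.last m
  have hC : ∀ c, c ∈ C ↔ c ∈ L ∧ ∀ h : c ∈ skewCells L M, T ⟨c, h⟩ ≠ Fin.last m := fun c => by
    simp [C]
  have hlow : IsLowerSet (C : Set (ℕ × ℕ)) := by
    intro c d hdc hc
    rw [Finset.mem_coe, hC] at hc ⊢
    refine ⟨L.up_left_mem hdc.1 hdc.2 hc.1, fun hd => ?_⟩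
    have hcM : c ∈ skewCells L M := mem_skewCells_iff.2
      ⟨hc.1, fun h => (mem_skewCells_iff.1 hd).2 (M.up_left_mem hdc.1 hdc.2 h)⟩
    have h1 : T ⟨d, hd⟩ ≤ T ⟨c, hcM⟩ := hT.mono hdc
    exact (h1.trans_lt (Fin.lt_last_iff_ne_last.2 (hc.2 hcM))).ne
  let V : YoungDiagram := ⟨C, hlow⟩
  have hV : ∀ c, c ∈ V ↔ c ∈ L ∧ ∀ h : c ∈ skewCells L M, T ⟨c, h⟩ ≠ Fin.last m := hC
  refine ⟨V, mem_horizontalRemovals.2 ⟨fun c hc => ((hV c).1 hc).1, fun c hc => ?_, fun j => ?_⟩,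
    fun c => ?_⟩
  · exact (hV c).2 ⟨hML hc, fun h => absurd hc (mem_skewCells_iff.1 h).2⟩
  · by_contra hj
    have hout : ∀ a, V.colLen j ≤ a → a < L.colLen j →
        ∃ h : (a, j) ∈ skewCells L M, T ⟨(a, j), h⟩ = Fin.last m := by
      intro a h1 h2
      by_contra hne
      push Not at hne
      have : (a, j) ∈ V := (hV _).2 ⟨YoungDiagram.mem_iff_lt_colLen.2 h2, hne⟩
      have := YoungDiagram.mem_iff_lt_colLen.1 this
      omega
    obtain ⟨h1, h1'⟩ := hout (V.colLen j) le_rfl (by omega)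
    obtain ⟨h2, h2'⟩ := hout (V.colLen j + 1) (by omega) (by omega)
    have := hT.2 ⟨_, h1⟩ ⟨_, h2⟩ rfl (Nat.lt_succ_self _)
    rw [h1', h2'] at this
    exact lt_irrefl _ this
  · rw [hV]
    exact ⟨fun h => ⟨(mem_skewCells_iff.1 c.2).1, fun _ => h⟩, fun h => h.2 c.2⟩

theorem skewCells_subset_right (hVL : V ≤ L) : skewCells V M ⊆ skewCells L M := fun c hc => by
  rw [mem_skewCells_iff] at hc ⊢
  exact ⟨hVL hc.1, hc.2⟩

/-- Extend a filling of `V / M` to `L / M` by the largest entry. -/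
def extendLast (T : skewCells V M → Fin m) : skewCells L M → Fin (m + 1) :=
  open Classical in fun c =>
    if h : c.1 ∈ V then
      (T ⟨c.1, mem_skewCells_iff.2 ⟨h, (mem_skewCells_iff.1 c.2).2⟩⟩).castSucc
    else Fin.last m

theorem extendLast_of_mem (T : skewCells V M → Fin m) {c : ℕ × ℕ} (hc : c ∈ skewCells L M)
    (h : c ∈ skewCells V M) :
    extendLast T (⟨c, hc⟩ : skewCells L M) = (T ⟨c, h⟩).castSucc := by
  rw [extendLast, dif_pos (mem_skewCells_iff.1 h).1]

theorem extendLast_of_notMem (T : skewCells V M → Fin m) {c : skewCells L M} (h : c.1 ∉ V) :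
    extendLast T c = Fin.last m := by
  rw [extendLast, dif_neg h]

theorem isInner_extendLast (T : skewCells V M → Fin m) :
    IsInner (extendLast T : skewCells L M → Fin (m + 1)) V := by
  rintro ⟨c, hc⟩
  by_cases h : c ∈ V
  · rw [extendLast_of_mem T hc (mem_skewCells_iff.2 ⟨h, (mem_skewCells_iff.1 hc).2⟩)]
    simpa [Fin.castSucc_ne_last] using h
  · rw [extendLast_of_notMem T h]
    simpa using h

/-- New boxes all carry the maximum, so only columns could fail; the horizontal strip condition
allows at most one new box per column. -/
theorem isSemistandard_extendLast {T : skewCells V M → Fin m} (hV : V ∈ horizontalRemovals L M)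
    (hT : IsSemistandard V M T) :
    IsSemistandard L M (extendLast T : skewCells L M → Fin (m + 1)) := by
  obtain ⟨-, -, hcol⟩ := mem_horizontalRemovals.1 hV
  constructor
  · rintro ⟨⟨i, j⟩, hc⟩ ⟨⟨i', j'⟩, hd⟩ h1 h2
    obtain rfl : i = i' := h1
    have h2 : j < j' := h2
    by_cases hdV : (i, j') ∈ V
    · have hcV : (i, j) ∈ V := V.up_left_mem le_rfl h2.le hdV
      have hc' := mem_skewCells_iff.2 ⟨hcV, (mem_skewCells_iff.1 hc).2⟩
      have hd' := mem_skewCells_iff.2 ⟨hdV, (mem_skewCells_iff.1 hd).2⟩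
      rw [extendLast_of_mem T hc hc', extendLast_of_mem T hd hd', Fin.castSucc_le_castSucc_iff]
      exact hT.1 _ _ rfl h2
    · rw [extendLast_of_notMem T (c := ⟨(i, j'), hd⟩) hdV]
      exact Fin.le_last _
  · rintro ⟨⟨i, j⟩, hc⟩ ⟨⟨i', j'⟩, hd⟩ h1 h2
    obtain rfl : j = j' := h1
    have h2 : i < i' := h2
    have hcV : (i, j) ∈ V := by
      rw [YoungDiagram.mem_iff_lt_colLen]
      have h3 := YoungDiagram.mem_iff_lt_colLen.1 (mem_skewCells_iff.1 hd).1
      have h4 := hcol j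
      omega
    have hc' := mem_skewCells_iff.2 ⟨hcV, (mem_skewCells_iff.1 hc).2⟩
    by_cases hdV : (i', j) ∈ V
    · have hd' := mem_skewCells_iff.2 ⟨hdV, (mem_skewCells_iff.1 hd).2⟩
      rw [extendLast_of_mem T hc hc', extendLast_of_mem T hd hd', Fin.castSucc_lt_castSucc_iff]
      exact hT.2 _ _ rfl h2
    · rw [extendLast_of_mem T hc hc', extendLast_of_notMem T (c := ⟨(i', j), hd⟩) hdV]
      exact Fin.castSucc_lt_last _

variable {R : Type*} [CommRing R]

theorem prod_extendLast (hV : V ∈ horizontalRemovals L M) (T : skewCells V M → Fin m)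
    (y : Fin (m + 1) → R) :
    ∏ c : skewCells L M, y (extendLast T c) =
      y (Fin.last m) ^ (skewCells L V).card * ∏ c, y (T c).castSucc := by
  classical
  obtain ⟨hVL, hMV, -⟩ := mem_horizontalRemovals.1 hV
  let F : ℕ × ℕ → R := fun c =>
    if h : c ∈ skewCells V M then y (T ⟨c, h⟩).castSucc else y (Fin.last m)
  have h1 : ∏ c : skewCells L M, y (extendLast T c) = ∏ c ∈ skewCells L M, F c := by
    rw [← Finset.prod_coe_sort (skewCells L M) F]
    refine Finset.prod_congr rfl fun c _ => ?_
    by_cases h : c.1 ∈ skewCells V M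
    · simp only [F, dif_pos h]
      rw [extendLast_of_mem T c.2 h]
    · simp only [F, dif_neg h]
      rw [extendLast_of_notMem T fun hc =>
        h (mem_skewCells_iff.2 ⟨hc, (mem_skewCells_iff.1 c.2).2⟩)]
  have h2 : ∏ c : skewCells V M, y (T c).castSucc = ∏ c ∈ skewCells V M, F c := by
    rw [← Finset.prod_coe_sort (skewCells V M) F]
    refine Finset.prod_congr rfl fun c _ => ?_
    simp only [F, dif_pos c.2]
  have h3 : skewCells L M \ skewCells V M = skewCells L V := by
    ext c
    simp only [Finset.mem_sdiff, mem_skewCells_iff]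
    have := @hMV c
    tauto
  rw [h1, h2, ← Finset.prod_sdiff (skewCells_subset_right hVL), h3, Finset.prod_congr rfl,
    Finset.prod_const]
  intro c hc
  exact dif_neg fun h => (mem_skewCells_iff.1 hc).2 (mem_skewCells_iff.1 h).1

theorem sum_isInner (hV : V ∈ horizontalRemovals L M) (y : Fin (m + 1) → R) :
    open Classical in
    ∑ T : skewCells L M → Fin (m + 1) with IsSemistandard L M T ∧ IsInner T V, ∏ c, y (T c) =
      y (Fin.last m) ^ (skewCells L V).card * skewSchur V M fun i => y i.castSucc := by
  classical
  obtain ⟨hVL, hMV, -⟩ := mem_horizontalRemovals.1 hV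
  rw [skewSchur, Finset.mul_sum]
  symm
  refine Finset.sum_bij (fun T _ => extendLast T) ?_ ?_ ?_ ?_
  · intro T hT
    simp only [Finset.mem_filter, Finset.mem_univ, true_and] at hT ⊢
    exact ⟨isSemistandard_extendLast hV hT, isInner_extendLast T⟩
  · intro T _ T' _ h
    funext c
    have hc := skewCells_subset_right (M := M) hVL c.2
    have := congrFun h ⟨c.1, hc⟩
    rw [extendLast_of_mem T hc c.2, extendLast_of_mem T' hc c.2] at this
    exact Fin.castSucc_injective _ this
  · intro T hT
    simp only [Finset.mem_filter, Finset.mem_univ, true_and] at hT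
    obtain ⟨hT, hTV⟩ := hT
    have hne : ∀ c : skewCells V M, T ⟨c.1, skewCells_subset_right hVL c.2⟩ ≠ Fin.last m :=
      fun c => (hTV _).2 (mem_skewCells_iff.1 c.2).1
    refine ⟨fun c => (T ⟨c.1, skewCells_subset_right hVL c.2⟩).castPred (hne c), ?_, ?_⟩
    · simp only [Finset.mem_filter, Finset.mem_univ, true_and]
      refine ⟨fun c d h1 h2 => ?_, fun c d h1 h2 => ?_⟩
      · rw [Fin.castPred_le_castPred_iff]
        exact hT.1 _ _ h1 h2
      · rw [Fin.castPred_lt_castPred_iff]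
        exact hT.2 _ _ h1 h2
    · funext c
      obtain ⟨c, hc⟩ := c
      by_cases h : c ∈ V
      · rw [extendLast_of_mem _ hc (mem_skewCells_iff.2 ⟨h, (mem_skewCells_iff.1 hc).2⟩)]
        simp
      · rw [extendLast_of_notMem _ (c := ⟨c, hc⟩) h]
        by_contra hne
        exact h ((hTV ⟨c, hc⟩).1 (Ne.symm hne))
  · intro T _
    exact (prod_extendLast hV T y).symm

/-- The branching rule: split off the horizontal strip of the boxes with the largest entry. -/
theorem skewSchur_succ (hML : M ≤ L) (y : Fin (m + 1) → R) :
    skewSchur L M y = ∑ V ∈ horizontalRemovals L M,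
      y (Fin.last m) ^ (skewCells L V).card * skewSchur V M fun i => y i.castSucc := by
  classical
  rw [skewSchur, Finset.sum_congr rfl fun V hV => (sum_isInner hV y).symm]
  let g : (skewCells L M → Fin (m + 1)) → YoungDiagram := fun T =>
    if h : IsSemistandard L M T then (h.exists_isInner hML).choose else L
  have hg : ∀ T, IsSemistandard L M T → g T ∈ horizontalRemovals L M ∧ IsInner T (g T) := by
    intro T h
    simp only [g, dif_pos h]
    exact (h.exists_isInner hML).choose_spec
  rw [← Finset.sum_fiberwise_of_maps_to (g := g) (t := horizontalRemovals L M)]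
  · refine Finset.sum_congr rfl fun V hV => Finset.sum_congr ?_ fun _ _ => rfl
    ext T
    simp only [Finset.mem_filter, Finset.mem_univ, true_and]
    refine and_congr_right fun hT => ⟨?_, fun h => ?_⟩
    · rintro rfl
      exact (hg T hT).2
    · exact (hg T hT).2.unique h (hg T hT).1 hV
  · intro T hT
    exact (hg T (by simpa using hT)).1

theorem skewSchur_self (L : YoungDiagram) (y : Fin m → R) : skewSchur L L y = 1 := by
  classical
  have hE : IsEmpty (skewCells L L) := ⟨fun c => (mem_skewCells_iff.1 c.2).2
    (mem_skewCells_iff.1 c.2).1⟩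
  rw [skewSchur, Finset.filter_true_of_mem]
  · simp
  · intro T _
    exact ⟨fun c => hE.elim c, fun c => hE.elim c⟩

theorem skewSchur_zero_eq_zero (hML : M ≤ L) (hne : M ≠ L) (y : Fin 0 → R) :
    skewSchur L M y = 0 := by
  classical
  obtain ⟨c, hc⟩ : ∃ c, c ∈ skewCells L M := by
    by_contra h
    push Not at h
    refine hne (le_antisymm hML fun c hc => ?_)
    by_contra hM
    exact h c (mem_skewCells_iff.2 ⟨hc, hM⟩)
  rw [skewSchur]
  exact Finset.sum_eq_zero fun T _ => (T ⟨c, hc⟩).elim0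

end Branching

/-! ### Sums of skew Schur polynomials as alternants -/

theorem card_skewCells_transpose (lam mu : YoungDiagram) :
    (skewCells lam.transpose mu.transpose).card = (skewCells lam mu).card := by
  refine Finset.card_bij (fun c _ => c.swap) ?_ ?_ ?_
  · intro c hc
    simpa [mem_skewCells_iff, YoungDiagram.mem_transpose] using hc
  · intro c _ d _ h
    exact Prod.swap_injective h
  · intro c hc
    refine ⟨c.swap, ?_, Prod.swap_swap c⟩
    simpa [mem_skewCells_iff, YoungDiagram.mem_transpose] using hc

open Classical in
/-- The diagrams `nu ≤ lam` such that `lam / nu` is a vertical strip. -/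
def verticalRemovals (lam : YoungDiagram) : Finset YoungDiagram :=
  (subdiagrams lam).filter fun nu => ∀ i, lam.rowLen i ≤ nu.rowLen i + 1

theorem mem_verticalRemovals {nu lam : YoungDiagram} :
    nu ∈ verticalRemovals lam ↔ nu ≤ lam ∧ ∀ i, lam.rowLen i ≤ nu.rowLen i + 1 := by
  simp [verticalRemovals, mem_subdiagrams]

theorem transpose_mem_horizontalRemovals {mu nu lam : YoungDiagram} :
    nu.transpose ∈ horizontalRemovals lam.transpose mu.transpose ↔
      nu ∈ verticalRemovals lam ∧ mu ≤ nu := by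
  rw [mem_horizontalRemovals, mem_verticalRemovals]
  simp only [YoungDiagram.transpose_le_iff, YoungDiagram.colLen_transpose]
  tauto

/-- A vertical strip has one box in each of its non-empty rows. -/
theorem card_skewCells_of_mem_verticalRemovals {nu lam : YoungDiagram} {N : ℕ}
    (h : nu ∈ verticalRemovals lam) (hN : lam.rowLen N = 0) :
    (skewCells lam nu).card =
      ((Finset.univ : Finset (Fin N)).filter fun j : Fin N => nu.rowLen j < lam.rowLen j).card := by
  obtain ⟨hle, hv⟩ := mem_verticalRemovals.1 h
  symm
  refine Finset.card_bij (fun j _ => ((j : ℕ), nu.rowLen j)) ?_ ?_ ?_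
  · intro j hj
    exact mem_skewCells.2 ⟨le_rfl, by simpa using hj⟩
  · intro j _ j' _ h
    exact Fin.ext (Prod.ext_iff.1 h).1
  · rintro ⟨i, k⟩ hc
    have h1 := mem_skewCells.1 hc
    have h2 := hv i
    simp only at h1
    have hi : i < N := by
      by_contra hi
      have := rowLen_eq_zero_of_le hN (i := i) (by omega)
      omega
    refine ⟨⟨i, hi⟩, ?_, ?_⟩
    · simp only [Finset.mem_filter, Finset.mem_univ, true_and]
      omega
    · simp only [Prod.mk.injEq, true_and]
      omega

/-! ### From vertical strips to twisted functions -/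

variable {K : Type*} [CommRing K] {m : ℕ}

/-- The sum `∑_{mu ⊆ lam} G(mu) s_{lam'/mu'}(y)`. -/
def skewSum (G : YoungDiagram → K) (lam : YoungDiagram) (y : Fin m → K) : K :=
  ∑ mu ∈ subdiagrams lam, G mu * skewSchur lam.transpose mu.transpose y

theorem skewSum_zero (G : YoungDiagram → K) (lam : YoungDiagram) (y : Fin 0 → K) :
    skewSum G lam y = G lam := by
  rw [skewSum, Finset.sum_eq_single lam]
  · rw [skewSchur_self, mul_one]
  · intro mu hmu hne
    rw [skewSchur_zero_eq_zero (YoungDiagram.transpose_mono (mem_subdiagrams.1 hmu)), mul_zero]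
    rwa [Ne, YoungDiagram.transpose_eq_iff]
  · intro h
    exact absurd (mem_subdiagrams.2 le_rfl) h

/-- Branch each skew Schur polynomial on its last variable and interchange the sums over `mu` and
the intermediate shape; transposition turns horizontal strips into vertical ones. -/
theorem skewSum_succ (G : YoungDiagram → K) (lam : YoungDiagram) (y : Fin (m + 1) → K) :
    skewSum G lam y = ∑ nu ∈ verticalRemovals lam,
      y (Fin.last m) ^ (skewCells lam nu).card * skewSum G nu fun i => y i.castSucc := by
  have h : ∀ mu ∈ subdiagrams lam, G mu * skewSchur lam.transpose mu.transpose y =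
      ∑ V ∈ horizontalRemovals lam.transpose mu.transpose, G mu *
        (y (Fin.last m) ^ (skewCells lam.transpose V).card *
          skewSchur V mu.transpose fun i => y i.castSucc) := by
    intro mu hmu
    rw [skewSchur_succ (YoungDiagram.transpose_mono (mem_subdiagrams.1 hmu)), Finset.mul_sum]
  simp only [skewSum, Finset.mul_sum]
  rw [Finset.sum_congr rfl h, Finset.sum_sigma', Finset.sum_sigma']
  refine Finset.sum_bij' (fun p _ => ⟨p.2.transpose, p.1⟩) (fun p _ => ⟨p.2, p.1.transpose⟩)
    ?_ ?_ ?_ ?_ ?_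
  · rintro ⟨mu, V⟩ h
    simp only [Finset.mem_sigma] at h ⊢
    have h2 := h.2
    rw [← V.transpose_transpose, transpose_mem_horizontalRemovals] at h2
    exact ⟨h2.1, mem_subdiagrams.2 h2.2⟩
  · rintro ⟨nu, mu⟩ h
    simp only [Finset.mem_sigma, mem_subdiagrams] at h ⊢
    exact ⟨h.2.trans (mem_verticalRemovals.1 h.1).1, transpose_mem_horizontalRemovals.2 h⟩
  · rintro ⟨mu, V⟩ _
    simp
  · rintro ⟨nu, mu⟩ _
    simp
  · rintro ⟨mu, V⟩ _
    simp only [YoungDiagram.transpose_transpose]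
    rw [← card_skewCells_transpose lam, YoungDiagram.transpose_transpose]
    ring

/-- The function `∏_k (1 + y_k S⁻¹) g` on the integers, where `S⁻¹ g (a) = g (a - 1)`. -/
def twist : {m : ℕ} → (Fin m → K) → (ℤ → K) → ℤ → K
  | 0, _, g => g
  | m + 1, y, g => fun a => twist (fun i => y i.castSucc) g a +
      y (Fin.last m) * twist (fun i => y i.castSucc) g (a - 1)

theorem twist_zero (y : Fin 0 → K) (g : ℤ → K) : twist y g = g := rfl

theorem twist_succ (y : Fin (m + 1) → K) (g : ℤ → K) (a : ℤ) :
    twist y g a = twist (fun i => y i.castSucc) g a +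
      y (Fin.last m) * twist (fun i => y i.castSucc) g (a - 1) := rfl

theorem twist_eq_zero_of_le {c : ℤ} {g : ℤ → K} (h : ∀ a ≤ c, g a = 0) (y : Fin m → K) :
    ∀ a ≤ c, twist y g a = 0 := by
  induction m with
  | zero => exact h
  | succ m ih =>
    intro a ha
    rw [twist_succ, ih _ a ha, ih _ (a - 1) (by omega), mul_zero, add_zero]

/-- Each factor looks back by one, so the value at `a` depends only on the values of `g` on `[a - m,
a]`. This is where `m` enters the bound on `lam`. -/
theorem twist_congr_of_ge {c : ℤ} {g g' : ℤ → K} (h : ∀ a, c ≤ a → g a = g' a)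
    (y : Fin m → K) : ∀ a, c + m ≤ a → twist y g a = twist y g' a := by
  induction m with
  | zero =>
    intro a ha
    exact h a (by simpa using ha)
  | succ m ih =>
    intro a ha
    push_cast at ha
    rw [twist_succ, twist_succ, ih _ a (by omega), ih _ (a - 1) (by omega)]

theorem twist_zero_fun (y : Fin m → K) (a : ℤ) : twist y (fun _ => 0) a = 0 :=
  twist_eq_zero_of_le (c := a) (fun _ _ => rfl) y a le_rfl

theorem twist_comp_add (g : ℤ → K) (c : ℤ) (y : Fin m → K) (a : ℤ) :
    twist y (fun b => g (b + c)) a = twist y g (a + c) := by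
  induction m generalizing a with
  | zero => rfl
  | succ m ih =>
    rw [twist_succ, twist_succ, ih, ih]
    congr 3
    ring

/-- The twist is a polynomial in the shift operator, hence commutes with the translations by `s` and
`-s`. -/
theorem twist_recurrence {g : ℤ → K} {s : ℤ} {p : K} (h : ∀ a, g (a + s) + g (a - s) = p * g a)
    (y : Fin m → K) (a : ℤ) : twist y g (a + s) + twist y g (a - s) = p * twist y g a := by
  induction m generalizing a with
  | zero => exact h a
  | succ m ih =>
    have h1 := ih (fun i => y i.castSucc) a
    have h2 := ih (fun i => y i.castSucc) (a - 1)
    rw [twist_succ, twist_succ, twist_succ]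
    rw [show a - 1 + s = a + s - 1 by ring, show a - 1 - s = a - s - 1 by ring] at h2
    linear_combination h1 + y (Fin.last m) * h2

/-- Multilinearity in the columns: `s` is the set of columns from which the shifted summand is
chosen. -/
theorem alternant_add_shift {N : ℕ} (f : Fin N → ℤ → K) (t : K) (a : Fin N → ℤ) :
    alternant (fun i b => f i b + t * f i (b - 1)) a =
      ∑ s : Finset (Fin N), t ^ s.card * alternant f fun j => a j - if j ∈ s then 1 else 0 := by
  have h1 : alternant (fun i b => f i b + t * f i (b - 1)) a =
      Matrix.detRowAlternating
        ((fun j i => t * f i (a j - 1)) + fun j i => f i (a j)) := by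
    rw [alternant, ← Matrix.det_transpose]
    refine congrArg Matrix.detRowAlternating (funext fun i => funext fun j => ?_)
    simp [add_comm]
  rw [h1, AlternatingMap.map_add_univ]
  refine Finset.sum_congr rfl fun s _ => ?_
  have h2 : t ^ s.card = ∏ j : Fin N, if j ∈ s then t else 1 := by
    rw [Finset.prod_ite_mem, Finset.univ_inter, Finset.prod_const]
  rw [h2, alternant, ← Matrix.det_mul_row, ← Matrix.det_transpose]
  refine congrArg Matrix.detRowAlternating (funext fun j => funext fun i => ?_)
  by_cases h : j ∈ s <;> simp [h, Finset.piecewise]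

/-- Removing vertical strips corresponds to shifting the functions of an alternant. -/
theorem sum_verticalRemovals {N : ℕ} (f : Fin N → ℤ → K) (hf : ∀ i, ∀ b ≤ -(N : ℤ), f i b = 0)
    (t : K) (lam : YoungDiagram) (hN : lam.rowLen N = 0) :
    ∑ nu ∈ verticalRemovals lam, t ^ (skewCells lam nu).card * alternant f (fun j => beta nu j) =
      alternant (fun i b => f i b + t * f i (b - 1)) fun j => beta lam j := by
  classical
  rw [alternant_add_shift]
  have hval : ∀ {nu : YoungDiagram}, nu ∈ verticalRemovals lam → ∀ i,
      nu.rowLen i + (if nu.rowLen i < lam.rowLen i then 1 else 0) = lam.rowLen i := by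
    intro nu h i
    obtain ⟨h1, h2⟩ := mem_verticalRemovals.1 h
    have h1 := le_iff_rowLen.1 h1 i
    have h2 := h2 i
    split_ifs <;> omega
  refine Finset.sum_of_injOn
    (fun nu => Finset.univ.filter fun j : Fin N => nu.rowLen j < lam.rowLen j) ?_ (by simp) ?_ ?_
  · intro nu h nu' h' heq
    refine ext_rowLen fun i => ?_
    have h1 := hval h i
    have h1' := hval h' i
    by_cases hi : i < N
    · have h2 := Finset.ext_iff.1 heq ⟨i, hi⟩
      simp only [Finset.mem_filter, Finset.mem_univ, true_and] at h2
      simp only [h2] at h1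
      omega
    · have := rowLen_eq_zero_of_le hN (i := i) (by omega)
      omega
  -- A set of rows whose removal does not leave a partition must contribute 0.
  · intro s _ hs
    by_contra hne
    have hne : alternant f (fun j => beta lam j - if j ∈ s then 1 else 0) ≠ 0 := fun h =>
      hne (by rw [h, mul_zero])
    let e : ℕ → ℤ := fun i => if h : i < N then (if (⟨i, h⟩ : Fin N) ∈ s then 1 else 0) else 0
    have he : ∀ j : Fin N, (if j ∈ s then (1 : ℤ) else 0) = e j := fun j => by
      simp [e]
    have he01 : ∀ i, 0 ≤ e i ∧ e i ≤ 1 := fun i => by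
      simp only [e]
      split_ifs <;> simp
    have heN : ∀ i, N ≤ i → e i = 0 := fun i hi => dif_neg (by omega)
    have hstep : ∀ i, (lam.rowLen (i + 1) : ℤ) - e (i + 1) ≤ lam.rowLen i - e i := by
      intro i
      have hanti := lam.rowLen_anti i (i + 1) (by omega)
      have b1 := he01 i
      have b2 := he01 (i + 1)
      by_contra hc
      -- A failure of monotonicity means equal rows of which only the upper loses a box, so two
      -- columns agree. At `i + 1 = N` it means a box taken from an empty last row, whose column
      -- then sits at `-N` and is zero.
      rcases lt_trichotomy (i + 1) N with hi | hi | hi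
      · refine hne (alternant_eq_zero_of_eq f (i := ⟨i, by omega⟩) (j := ⟨i + 1, hi⟩) ?_ ?_)
        · simp [Fin.ext_iff]
        · simp only [he, beta]
          push_cast
          omega
      · have := heN (i + 1) (by omega)
        rw [hi, hN, ← hi, this] at hc
        refine hne (alternant_eq_zero_of_col f ⟨i, by omega⟩ fun k => hf k _ ?_)
        simp only [he, beta]
        push_cast at hc ⊢
        omega
      · have h1 := heN i (by omega)
        have h2 := heN (i + 1) (by omega)
        omega
    have hanti : Antitone fun i => (lam.rowLen i : ℤ) - e i := antitone_nat_of_succ_le hstep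
    have hnonneg : ∀ i, 0 ≤ (lam.rowLen i : ℤ) - e i := by
      intro i
      by_cases hi : i < N
      · have h1 : (lam.rowLen N : ℤ) - e N ≤ lam.rowLen i - e i := hanti hi.le
        rw [hN, heN N le_rfl] at h1
        simpa using h1
      · rw [heN i (by omega)]
        simp
    obtain ⟨nu, hnu⟩ := exists_rowLen_eq (fun i => ((lam.rowLen i : ℤ) - e i).toNat)
      (fun i => Int.toNat_le_toNat (hstep i)) N (by simp [hN, heN N le_rfl])
    refine hs ⟨nu, ?_, ?_⟩
    · refine mem_verticalRemovals.2 ⟨le_iff_rowLen.2 fun i => ?_, fun i => ?_⟩ <;>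
        have := hnonneg i <;> have := he01 i <;> rw [hnu i] <;> omega
    · ext j
      have h1 := hnonneg j
      have h2 := he j
      simp only [Finset.mem_filter, Finset.mem_univ, true_and, hnu]
      split_ifs at h2 with h3
      · simp only [h3, iff_true]
        omega
      · simp only [h3, iff_false]
        omega
  · intro nu h
    rw [card_skewCells_of_mem_verticalRemovals h hN]
    congr 2
    funext j
    have := hval h j
    simp only [Finset.mem_filter, Finset.mem_univ, true_and, beta]
    split_ifs at this ⊢ <;> omega

theorem skewSum_eq_alternant {N : ℕ} (f : Fin N → ℤ → K) (hf : ∀ i, ∀ b ≤ -(N : ℤ), f i b = 0)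
    (G : YoungDiagram → K)
    (hG : ∀ mu : YoungDiagram, mu.rowLen N = 0 → G mu = alternant f fun j => beta mu j)
    (y : Fin m → K) (lam : YoungDiagram) (hN : lam.rowLen N = 0) :
    skewSum G lam y = alternant (fun i => twist y (f i)) fun j => beta lam j := by
  induction m generalizing lam with
  | zero =>
    rw [skewSum_zero, hG lam hN]
    rfl
  | succ m ih =>
    have h : ∀ nu ∈ verticalRemovals lam, nu.rowLen N = 0 := fun nu hnu => by
      have := le_iff_rowLen.1 (mem_verticalRemovals.1 hnu).1 N
      omega
    rw [skewSum_succ, Finset.sum_congr rfl fun nu hnu => by rw [ih _ nu (h nu hnu)],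
      sum_verticalRemovals _ (fun i => twist_eq_zero_of_le (hf i) _) _ lam hN]
    rfl

/-! ### Replacing the columns of a determinant -/

section Trace

variable {R : Type*} [CommRing R] {ι : Type*} [Fintype ι] [DecidableEq ι]

/-- Cramer's rule: the `j`-th summand is the `j`-th diagonal entry of `A.adjugate * G`. -/
theorem sum_det_updateCol (A G : Matrix ι ι R) :
    ∑ j, (A.updateCol j fun i => G i j).det = (A.adjugate * G).trace := by
  refine Finset.sum_congr rfl fun j _ => ?_
  rw [← Matrix.cramer_apply, Matrix.cramer_eq_adjugate_mulVec]
  rfl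

/-- Cyclicity of the trace moves `A` next to its adjugate, so `A` need not be invertible. -/
theorem sum_det_updateCol_smul (A : Matrix ι ι R) (p : ι → R) :
    ∑ j, (A.updateCol j fun i => p i * A i j).det = (∑ i, p i) * A.det := by
  have h : (fun i j => p i * A i j : Matrix ι ι R) = Matrix.diagonal p * A := by
    ext i j
    rw [Matrix.diagonal_mul]
  have h1 := sum_det_updateCol A (Matrix.diagonal p * A)
  simp only [Matrix.diagonal_mul] at h1
  rw [h1, Matrix.trace_mul_comm, Matrix.mul_assoc, Matrix.mul_adjugate, Matrix.mul_smul,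
    Matrix.trace_smul, mul_one, Matrix.trace_diagonal, smul_eq_mul, mul_comm]

end Trace

/-! ### The power sum as a trace of Toeplitz matrices -/

section Toeplitz

variable {K : Type*} [CommRing K] {m : ℕ}

/-- The `k`-th elementary symmetric polynomial, as the value at `k` of the twisted delta
function. -/
def elemCoeff (y : Fin m → K) : ℤ → K := twist y fun b => if b = 0 then 1 else 0

theorem elemCoeff_of_neg (y : Fin m → K) {k : ℤ} (hk : k < 0) : elemCoeff y k = 0 :=
  twist_eq_zero_of_le (c := -1) (fun _ ha => if_neg (by omega)) y k (by omega)

theorem elemCoeff_of_lt (y : Fin m → K) {k : ℤ} (hk : (m : ℤ) < k) : elemCoeff y k = 0 := by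
  rw [elemCoeff, twist_congr_of_ge (c := 1) (g' := fun _ => 0) (fun _ ha => if_neg (by omega)) y k
    (by omega), twist_zero_fun]

theorem elemCoeff_succ (y : Fin (m + 1) → K) (k : ℤ) :
    elemCoeff y k = elemCoeff (fun i => y i.castSucc) k +
      y (Fin.last m) * elemCoeff (fun i => y i.castSucc) (k - 1) := rfl

theorem elemCoeff_zero_right (y : Fin m → K) : elemCoeff y 0 = 1 := by
  induction m with
  | zero => simp [elemCoeff, twist_zero]
  | succ m ih => rw [elemCoeff_succ, ih, elemCoeff_of_neg _ (by omega), mul_zero, add_zero]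

/-- The lower unitriangular Toeplitz matrix `(e_{i-j})`. -/
def toeplitz (r : ℕ) (y : Fin m → K) : Matrix (Fin r) (Fin r) K :=
  Matrix.of fun i j => elemCoeff y ((i : ℤ) - j)

/-- The shifted Toeplitz matrix `(e_{i-j+r})`. -/
def shiftedToeplitz (r : ℕ) (y : Fin m → K) : Matrix (Fin r) (Fin r) K :=
  Matrix.of fun i j => elemCoeff y ((i : ℤ) - j + r)

/-- The lower bidiagonal matrix with diagonal `1` and subdiagonal `t`. -/
def bidiagonal (r : ℕ) (t : K) : Matrix (Fin r) (Fin r) K :=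
  Matrix.of fun i j => if i = j then 1 else if (i : ℕ) = j + 1 then t else 0

theorem det_toeplitz (r : ℕ) (y : Fin m → K) : (toeplitz r y).det = 1 := by
  rw [Matrix.det_of_isLowerTriangular]
  · simp [toeplitz, elemCoeff_zero_right]
  · intro i j hij
    have : i < j := hij
    exact elemCoeff_of_neg y (by rw [Fin.lt_def] at this; omega)

theorem det_bidiagonal (r : ℕ) (t : K) : (bidiagonal r t).det = 1 := by
  rw [Matrix.det_of_isLowerTriangular]
  · simp [bidiagonal]
  · intro i j hij
    have h : i < j := hij
    rw [bidiagonal, Matrix.of_apply, if_neg h.ne, if_neg]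
    rw [Fin.lt_def] at h
    omega

theorem sum_mul_bidiagonal {r : ℕ} (t : K) (F : ℤ → K) (j : Fin r) :
    ∑ l : Fin r, F l * bidiagonal r t l j =
      F j + t * if (j : ℕ) + 1 < r then F (j + 1) else 0 := by
  have h : ∀ l : Fin r, F l * bidiagonal r t l j =
      (if l = j then F l else 0) + if (l : ℕ) = j + 1 then t * F (j + 1) else 0 := by
    intro l
    simp only [bidiagonal, Matrix.of_apply]
    by_cases h1 : l = j
    · subst h1
      simp
    · by_cases h2 : (l : ℕ) = j + 1
      · simp [h1, h2, mul_comm]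
      · simp [h1, h2]
  rw [Finset.sum_congr rfl fun l _ => h l, Finset.sum_add_distrib, Finset.sum_ite_eq' Finset.univ j]
  congr 1
  · simp
  by_cases hj : (j : ℕ) + 1 < r
  · rw [if_pos hj, Finset.sum_eq_single ⟨j + 1, hj⟩]
    · simp
    · intro l _ hl
      exact if_neg fun h => hl (Fin.ext h)
    · simp
  · rw [if_neg hj, mul_zero]
    exact Finset.sum_eq_zero fun l _ => if_neg (by omega)

/-- The coefficients obey e_k(Y, t) = e_k(Y) + t e_{k-1}(Y). In the last column the term missing
from the bidiagonal product has negative index, hence is 0. -/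
theorem toeplitz_succ (r : ℕ) (y : Fin (m + 1) → K) :
    toeplitz r y = toeplitz r (fun i => y i.castSucc) * bidiagonal r (y (Fin.last m)) := by
  ext i j
  rw [Matrix.mul_apply]
  simp only [toeplitz, Matrix.of_apply]
  rw [sum_mul_bidiagonal _ (fun l => elemCoeff (fun i => y i.castSucc) ((i : ℤ) - l)),
    elemCoeff_succ]
  congr 2
  split_ifs with h
  · congr 1
    ring
  · exact elemCoeff_of_neg _ (by omega)

/-- Here the term missing in the last column has index `i`, so it is not 0: it is `t` times the
first column of the unshifted Toeplitz matrix, which the `single` term restores. This correction is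
the source of the power sum. -/
theorem shiftedToeplitz_succ (r : ℕ) (y : Fin (m + 1) → K) :
    shiftedToeplitz (r + 1) y =
      shiftedToeplitz (r + 1) (fun i => y i.castSucc) * bidiagonal (r + 1) (y (Fin.last m)) +
        y (Fin.last m) • (toeplitz (r + 1) (fun i => y i.castSucc) *
          Matrix.single 0 (Fin.last r) 1) := by
  ext i j
  rw [Matrix.add_apply, Matrix.mul_apply, Matrix.smul_apply]
  simp only [shiftedToeplitz, Matrix.of_apply]
  rw [sum_mul_bidiagonal _ (fun l => elemCoeff (fun i => y i.castSucc) ((i : ℤ) - l + (r + 1 : ℕ))),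
    elemCoeff_succ, add_assoc, smul_eq_mul, ← mul_add]
  congr 2
  by_cases h : j = Fin.last r
  · subst h
    rw [Matrix.mul_single_apply_same]
    simp only [Fin.val_last, lt_irrefl, if_false, zero_add, mul_one, toeplitz, Matrix.of_apply]
    congr 1
    push_cast
    simp only [Fin.val_zero, Nat.cast_zero]
    ring
  · rw [Matrix.mul_single_apply_of_ne _ _ _ _ _ h, add_zero, if_pos]
    · congr 1
      push_cast
      ring
    · have := Fin.val_lt_last h
      omega

/-- The first column of the inverse is the geometric vector of powers of `-t`, and the determinant
is 1. -/
theorem adjugate_bidiagonal_last_zero (r : ℕ) (t : K) :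
    (bidiagonal (r + 1) t).adjugate (Fin.last r) 0 = (-t) ^ r := by
  set v : Fin (r + 1) → K := fun i => (-t) ^ (i : ℕ) with hv
  have h1 : (bidiagonal (r + 1) t).mulVec v = Pi.single 0 1 := by
    ext i
    simp only [Matrix.mulVec, dotProduct, bidiagonal, Matrix.of_apply, hv]
    refine Fin.cases ?_ (fun i => ?_) i
    · rw [Finset.sum_eq_single 0]
      · simp
      · intro l _ hl
        rw [if_neg hl.symm, if_neg (by simp), zero_mul]
      · simp
    · rw [Pi.single_eq_of_ne (Fin.succ_ne_zero i), Finset.sum_eq_add i.succ i.castSucc]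
      · rw [if_pos rfl, if_neg, if_pos]
        · simp only [Fin.val_succ, Fin.val_castSucc]
          ring
        · simp
        · simp [Fin.ext_iff]
      · simp [Fin.ext_iff]
      · rintro l - ⟨hl1, hl2⟩
        rw [if_neg hl1.symm, if_neg, zero_mul]
        intro h
        apply hl2
        ext
        simp only [Fin.val_succ, Fin.val_castSucc] at h ⊢
        omega
      · simp
      · simp
  have h2 : (bidiagonal (r + 1) t).adjugate.mulVec ((bidiagonal (r + 1) t).mulVec v) = v := by
    rw [Matrix.mulVec_mulVec, Matrix.adjugate_mul, det_bidiagonal, one_smul, Matrix.one_mulVec]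
  rw [h1, Matrix.mulVec_single_one] at h2
  have h3 := congrFun h2 (Fin.last r)
  simpa [hv] using h3

/-- A form of Newton's identities. -/
theorem trace_adjugate_toeplitz (r : ℕ) (y : Fin m → K) :
    ((toeplitz (r + 1) y).adjugate * shiftedToeplitz (r + 1) y).trace =
      (-1) ^ r * ∑ k, y k ^ (r + 1) := by
  induction m with
  | zero =>
    have : shiftedToeplitz (r + 1) y = 0 := by
      ext i j
      exact elemCoeff_of_lt y (by push_cast; omega)
    simp [this]
  | succ m ih =>
    set D := toeplitz (r + 1) fun i => y i.castSucc with hD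
    set D' := shiftedToeplitz (r + 1) fun i => y i.castSucc with hD'
    set t := y (Fin.last m) with ht
    set B := bidiagonal (r + 1) t with hB
    have hBdet : B.det = 1 := det_bidiagonal _ _
    have hDdet : D.det = 1 := det_toeplitz _ _
    -- As the determinants are 1, adjugates are inverses. Conjugation by `B` disappears under the
    -- trace, and the correction term contributes `t * (-t) ^ r`, the new summand.
    have h1 : (B.adjugate * D.adjugate * (D' * B)).trace = (D.adjugate * D').trace := by
      rw [Matrix.mul_assoc, Matrix.trace_mul_comm, Matrix.mul_assoc, Matrix.mul_assoc,
        Matrix.mul_adjugate, hBdet, one_smul, Matrix.mul_one]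
    have h2 : (B.adjugate * D.adjugate * (D * Matrix.single 0 (Fin.last r) 1)).trace =
        (-t) ^ r := by
      rw [Matrix.mul_assoc, ← Matrix.mul_assoc D.adjugate, Matrix.adjugate_mul, hDdet, one_smul,
        Matrix.one_mul, Matrix.trace_mul_single, ← adjugate_bidiagonal_last_zero]
      simp [hB]
    rw [toeplitz_succ, shiftedToeplitz_succ, Matrix.adjugate_mul_distrib, Matrix.mul_add,
      Matrix.trace_add, Matrix.mul_smul, Matrix.trace_smul, h1, h2, ih, Fin.sum_univ_castSucc,
      smul_eq_mul, neg_pow]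
    ring

end Toeplitz

/-! ### The determinantal formula for orthosymplectic Schur polynomials -/

section Blocks

variable {K : Type*} [CommRing K] {n k : ℕ}

theorem alternant_append (f : Fin n → ℤ → K) (g : Fin k → ℤ → K) (a : Fin (n + k) → ℤ) :
    alternant (Fin.append f g) a =
      (Matrix.fromBlocks
        (Matrix.of fun i j => f i (a (Fin.castAdd k j)))
        (Matrix.of fun i j => f i (a (Fin.natAdd n j)))
        (Matrix.of fun i j => g i (a (Fin.castAdd k j)))
        (Matrix.of fun i j => g i (a (Fin.natAdd n j)))).det := by
  rw [alternant, ← Matrix.det_submatrix_equiv_self finSumFinEquiv]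
  congr 1
  ext (i | i) (j | j) <;> simp

theorem alternant_append_of_upper (f : Fin n → ℤ → K) (g : Fin k → ℤ → K) (a : Fin (n + k) → ℤ)
    (h : ∀ i j, f i (a (Fin.natAdd n j)) = 0) :
    alternant (Fin.append f g) a = alternant f (fun j => a (Fin.castAdd k j)) *
      alternant g fun j => a (Fin.natAdd n j) := by
  have hB : (Matrix.of fun i j => f i (a (Fin.natAdd n j))) = 0 := Matrix.ext h
  rw [alternant_append, hB, Matrix.det_fromBlocks_zero₁₂]
  rfl

theorem alternant_append_of_lower (f : Fin n → ℤ → K) (g : Fin k → ℤ → K) (a : Fin (n + k) → ℤ)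
    (h : ∀ i j, g i (a (Fin.castAdd k j)) = 0) :
    alternant (Fin.append f g) a = alternant f (fun j => a (Fin.castAdd k j)) *
      alternant g fun j => a (Fin.natAdd n j) := by
  have hC : (Matrix.of fun i j => g i (a (Fin.castAdd k j))) = 0 := Matrix.ext h
  rw [alternant_append, hC, Matrix.det_fromBlocks_zero₂₁]
  rfl

theorem alternant_update (f : Fin n → ℤ → K) (a : Fin n → ℤ) (q : Fin n) (u : ℤ) :
    alternant f (Function.update a q u) =
      ((Matrix.of fun i j => f i (a j)).updateCol q fun i => f i u).det := by
  rw [alternant]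
  congr 1
  ext i j
  by_cases h : j = q
  · subst h
    simp
  · simp [h]

end Blocks

variable {K : Type*} [Field K] {n m k : ℕ}

/-- The truncated function `b ↦ x ^ (b + n) - x ^ (-(b + n))` for `b + n > 0`. -/
def sympFun (n : ℕ) (x : K) (b : ℤ) : K :=
  if 0 < b + n then x ^ (b + n) - x ^ (-(b + n)) else 0

/-- The delta function at `c`. -/
def deltaFun (c b : ℤ) : K := if b = c then 1 else 0

theorem sympFun_of_le (x : K) {b : ℤ} (hb : b ≤ -(n : ℤ)) : sympFun n x b = 0 :=
  if_neg (by omega)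

/-- The untruncated expression also vanishes at `b = -n`; this extra value is needed for the sharp
bound on `lam`. -/
theorem sympFun_of_ge (x : K) {b : ℤ} (hb : -(n : ℤ) ≤ b) :
    sympFun n x b = x ^ (b + n) - x ^ (-(b + n)) := by
  rcases hb.eq_or_lt with rfl | hb
  · simp [sympFun]
  · exact if_pos (by omega)

/-- The functions whose alternants are the numerators of the symplectic Schur polynomials. -/
def baseFun (k : ℕ) (x : Fin n → K) : Fin (n + k) → ℤ → K :=
  Fin.append (fun i => sympFun n (x i)) fun i : Fin k => deltaFun (-(n : ℤ) - i)

theorem baseFun_of_le (x : Fin n → K) (i : Fin (n + k)) :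
    ∀ b ≤ -((n + k : ℕ) : ℤ), baseFun k x i b = 0 := by
  intro b hb
  push_cast at hb
  refine Fin.addCases (fun i => ?_) (fun i => ?_) i
  · rw [baseFun, Fin.append_left]
    exact sympFun_of_le _ (by omega)
  · rw [baseFun, Fin.append_right]
    exact if_neg (by omega)

theorem twist_baseFun (x : Fin n → K) (y : Fin m → K) :
    (fun i => twist y (baseFun k x i)) =
      Fin.append (fun i => twist y (sympFun n (x i)))
        fun i : Fin k => twist y (deltaFun (-(n : ℤ) - i)) := by
  funext i
  refine Fin.addCases (fun i => ?_) (fun i => ?_) i <;> simp [baseFun]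

theorem twist_deltaFun (y : Fin m → K) (c b : ℤ) :
    twist y (deltaFun c) b = elemCoeff y (b - c) := by
  rw [elemCoeff, sub_eq_add_neg, ← twist_comp_add]
  congr 1
  funext b
  simp only [deltaFun, ← sub_eq_add_neg, sub_eq_zero]

/-- The numerator of the Weyl character formula. -/
def sympNum (x : Fin n → K) (mu : YoungDiagram) : K :=
  if mu.colLen 0 ≤ n then altDet x fun j => mu.rowLen j + (n - j) else 0

theorem sympNum_eq_alternant (x : Fin n → K) (mu : YoungDiagram) (h : mu.rowLen (n + k) = 0) :
    sympNum x mu = alternant (baseFun k x) fun j => beta mu j := by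
  rw [baseFun, alternant_append]
  have hC : (Matrix.of fun (i : Fin k) (j : Fin n) =>
      (deltaFun (-(n : ℤ) - i) (beta mu (Fin.castAdd k j)) : K)) = 0 := by
    ext i j
    have := neg_lt_beta mu (N := n) j.2
    simp only [Matrix.of_apply, Fin.val_castAdd, deltaFun, Matrix.zero_apply]
    exact if_neg (by omega)
  rw [hC, Matrix.det_fromBlocks_zero₂₁, sympNum]
  by_cases hn : mu.colLen 0 ≤ n
  · have hD : (Matrix.of fun (i j : Fin k) =>
        (deltaFun (-(n : ℤ) - i) (beta mu (Fin.natAdd n j)) : K)) = 1 := by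
      ext i j
      have h0 := rowLen_eq_zero_of_le (colLen_le_iff.1 hn) (i := n + j) (by omega)
      simp only [Matrix.of_apply, Fin.val_natAdd, deltaFun, beta, h0, Matrix.one_apply,
        Fin.ext_iff]
      congr 1
      rw [eq_iff_iff]
      push_cast
      omega
    rw [if_pos hn, hD, Matrix.det_one, mul_one, altDet]
    congr 1
    ext i j
    have hb := neg_lt_beta mu (N := n) j.2
    simp only [Matrix.of_apply, Fin.val_castAdd, sympFun]
    have he : beta mu j + n = ((mu.rowLen j + (n - j) : ℕ) : ℤ) := by
      have := j.2
      simp only [beta]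
      omega
    rw [if_pos (by omega), he, zpow_neg, zpow_natCast, inv_pow]
  · rw [if_neg hn]
    have hpos : 0 < mu.rowLen n := Nat.pos_of_ne_zero fun h => hn (colLen_le_iff.2 h)
    have hk : 0 < k := by
      rcases Nat.eq_zero_or_pos k with rfl | hk
      · rw [add_zero] at h
        omega
      · exact hk
    -- With row `n` nonempty, its argument exceeds `-n` and misses every delta point, so the corner
    -- block has a zero column.
    rw [Matrix.det_eq_zero_of_column_eq_zero (A := Matrix.of fun (i j : Fin k) =>
        (deltaFun (-(n : ℤ) - i) (beta mu (Fin.natAdd n j)) : K)) ⟨0, hk⟩, mul_zero]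
    intro i
    simp only [Matrix.of_apply, Fin.val_natAdd, deltaFun, beta, Nat.add_zero]
    exact if_neg (by omega)

theorem spo_eq_skewSum (lam : YoungDiagram) (x : Fin n → K) (y : Fin m → K) :
    spo lam x y = skewSum (sympNum x) lam y / altDet x fun j => n - j := by
  rw [spo, skewSum, Finset.sum_div]
  refine Finset.sum_congr rfl fun mu _ => ?_
  rw [symplecticSchur, sympNum]
  split_ifs <;> ring

theorem spo_eq_alternant (k : ℕ) (lam : YoungDiagram) (x : Fin n → K) (y : Fin m → K)
    (h : lam.rowLen (n + k) = 0) :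
    spo lam x y = alternant (fun i => twist y (baseFun k x i)) (fun j => beta lam j) /
      altDet x fun j => n - j := by
  rw [spo_eq_skewSum, skewSum_eq_alternant _ (baseFun_of_le x) _
    (fun mu hmu => sympNum_eq_alternant x mu hmu) y lam h]

/-! ### Multiplication by the power sum -/

/-- All three arguments are at least `-n + m`, so the twist looks back no further than `-n` and sees
the untruncated function, which satisfies the recurrence on all of ℤ. -/
theorem twist_sympFun_recurrence {x : K} (hx : x ≠ 0) (y : Fin m → K) (r : ℕ) {b : ℤ}
    (hb : -(n : ℤ) + m ≤ b - r) :
    twist y (sympFun n x) (b + r) + twist y (sympFun n x) (b - r) =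
      (x ^ r + x⁻¹ ^ r) * twist y (sympFun n x) b := by
  have h : ∀ a, -(n : ℤ) + m ≤ a → twist y (sympFun n x) a =
      twist y (fun b => x ^ (b + n) - x ^ (-(b + n))) a :=
    twist_congr_of_ge (fun a ha => sympFun_of_ge x ha) y
  rw [h _ (by omega), h _ hb, h b (by omega)]
  refine twist_recurrence (fun a => ?_) y b
  have h' : x⁻¹ ^ r = x ^ (-(r : ℤ)) := by rw [zpow_neg, zpow_natCast, inv_pow]
  simp only [h', ← zpow_natCast, add_mul, mul_sub, ← zpow_add₀ hx]
  ring_nf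

/-- The matrix of the alternant of a diagram with `n` long rows is block diagonal; the shifts of
its columns by `± r` reproduce it up to the power sum. -/
theorem sum_alternant_shift {r : ℕ} (x : Fin n → K) (hx : ∀ i, x i ≠ 0) (y : Fin m → K)
    (lam : YoungDiagram) (hlen : lam.rowLen n = 0)
    (hlam : ∀ j < n, (m : ℤ) + (r + 1 : ℕ) - n ≤ beta lam j) :
    superPowerSum (r + 1) x y *
        alternant (fun i => twist y (baseFun (r + 1) x i)) (fun j => beta lam j) =
      ∑ q : Fin (n + (r + 1)), alternant (fun i => twist y (baseFun (r + 1) x i))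
          (Function.update (fun j => beta lam j) q (beta lam q + (r + 1 : ℕ))) +
        ∑ q : Fin (n + (r + 1)), alternant (fun i => twist y (baseFun (r + 1) x i))
          (Function.update (fun j => beta lam j) q (beta lam q - (r + 1 : ℕ))) := by
  set p := r + 1 with hp
  set F : Fin n → ℤ → K := fun i => twist y (sympFun n (x i)) with hF
  set g : Fin p → ℤ → K := fun i => twist y (deltaFun (-(n : ℤ) - i)) with hg
  set b : Fin (n + p) → ℤ := fun j => beta lam j with hb
  set A : Matrix (Fin n) (Fin n) K := Matrix.of fun i j => F i (beta lam j) with hA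
  -- Upper right block: the rows from `n` on are empty, so their arguments are at most `-n`.
  have hF0 : ∀ i (j : Fin p), F i (b (Fin.natAdd n j)) = 0 := fun i j => by
    have h0 := rowLen_eq_zero_of_le hlen (i := n + j) (by omega)
    refine twist_eq_zero_of_le (fun _ => sympFun_of_le _) y _ ?_
    simp only [hb, Fin.val_natAdd, beta, h0]
    push_cast
    omega
  have hgval : ∀ (i j : Fin p) (c : ℤ),
      g i (b (Fin.natAdd n j) + c) = elemCoeff y ((i : ℤ) - j + c) := fun i j c => by
    have h0 := rowLen_eq_zero_of_le hlen (i := n + j) (by omega)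
    simp only [hg, twist_deltaFun, hb, Fin.val_natAdd, beta, h0]
    congr 1
    push_cast
    ring
  have hgval0 : ∀ i j : Fin p, g i (b (Fin.natAdd n j)) = toeplitz p y i j := fun i j => by
    have := hgval i j 0
    rw [add_zero, add_zero] at this
    exact this
  -- Lower left block: the index is at least `m + p`, beyond the last nonzero elementary symmetric
  -- polynomial.
  have hg0 : ∀ i (j : Fin n), g i (b (Fin.castAdd p j)) = 0 := fun i j => by
    have := hlam j j.2
    simp only [hg, twist_deltaFun, hb, Fin.val_castAdd]
    exact elemCoeff_of_lt y (by omega)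
  have hD : (Matrix.of fun i j => g i (b (Fin.natAdd n j))) = toeplitz p y := Matrix.ext hgval0
  have hgb : alternant g (fun j => b (Fin.natAdd n j)) = 1 := by
    rw [alternant, hD, det_toeplitz]
  have h0 : alternant (Fin.append F g) b = A.det := by
    rw [alternant_append_of_upper F g b hF0, hgb, mul_one]
    rfl
  -- A shift among the first `n` columns may spoil the lower left block but leaves the upper right
  -- one zero, so the determinant still factors; for the last `p` columns the roles are exchanged.
  have h1 : ∀ (q : Fin n) (u : ℤ), alternant (Fin.append F g)
      (Function.update b (Fin.castAdd p q) u) = (A.updateCol q fun i => F i u).det := by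
    intro q u
    have hne : ∀ j : Fin p, Function.update b (Fin.castAdd p q) u (Fin.natAdd n j) =
        b (Fin.natAdd n j) := fun j => Function.update_of_ne (by simp [Fin.ext_iff]; omega) _ _
    have hup : (fun j => Function.update b (Fin.castAdd p q) u (Fin.castAdd p j)) =
        Function.update (fun j => b (Fin.castAdd p j)) q u :=
      Function.update_comp_eq_of_injective b (Fin.castAdd_injective n p) q u
    rw [alternant_append_of_upper F g _ fun i j => by rw [hne, hF0], hup, alternant_update]
    simp only [hne]
    rw [hgb, mul_one]
    rfl
  have h2 : ∀ (q : Fin p) (u : ℤ), alternant (Fin.append F g)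
      (Function.update b (Fin.natAdd n q) u) =
        A.det * ((toeplitz p y).updateCol q fun i => g i u).det := by
    intro q u
    have hne : ∀ j : Fin n, Function.update b (Fin.natAdd n q) u (Fin.castAdd p j) =
        b (Fin.castAdd p j) := fun j => Function.update_of_ne (by simp [Fin.ext_iff]; omega) _ _
    have hup : (fun j => Function.update b (Fin.natAdd n q) u (Fin.natAdd n j)) =
        Function.update (fun j => b (Fin.natAdd n j)) q u :=
      Function.update_comp_eq_of_injective b (Fin.natAdd_injective p n) q u
    rw [alternant_append_of_lower F g _ fun i j => by rw [hne, hg0], hup, alternant_update, hD]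
    simp only [hne]
    rfl
  have h3 : ∑ q : Fin n, (A.updateCol q fun i => F i (beta lam q + p)).det +
      ∑ q : Fin n, (A.updateCol q fun i => F i (beta lam q - p)).det =
        (∑ i, (x i ^ p + (x i)⁻¹ ^ p)) * A.det := by
    rw [← Finset.sum_add_distrib, ← sum_det_updateCol_smul A fun i => x i ^ p + (x i)⁻¹ ^ p]
    refine Finset.sum_congr rfl fun q _ => ?_
    rw [← Matrix.det_updateCol_add]
    congr 2
    funext i
    have := hlam q q.2
    exact twist_sympFun_recurrence (hx i) y p (by omega)
  have h4 : ∑ q : Fin p, ((toeplitz p y).updateCol q fun i =>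
      g i (b (Fin.natAdd n q) + p)).det = (-1) ^ r * ∑ j, y j ^ p := by
    rw [← trace_adjugate_toeplitz, ← sum_det_updateCol]
    simp only [hgval]
    rfl
  -- The indices `i - q - p` are all negative.
  have h5 : ∀ q : Fin p, ((toeplitz p y).updateCol q fun i =>
      g i (b (Fin.natAdd n q) - p)).det = 0 := by
    intro q
    refine Matrix.det_eq_zero_of_column_eq_zero q fun i => ?_
    rw [Matrix.updateCol_self, sub_eq_add_neg, hgval]
    exact elemCoeff_of_neg y (by omega)
  rw [twist_baseFun]
  change _ * alternant (Fin.append F g) b =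
    ∑ q, alternant (Fin.append F g) (Function.update b q (b q + p)) +
      ∑ q, alternant (Fin.append F g) (Function.update b q (b q - p))
  simp only [Fin.sum_univ_add, h1, h2, h5, h0, mul_zero, Finset.sum_const_zero, add_zero]
  rw [← Finset.mul_sum, h4, superPowerSum, show p - 1 = r from Nat.add_sub_cancel r 1, add_mul, ← h3]
  simp only [hb, Fin.val_castAdd]
  ring

theorem superPowerSum_mul_spo {r : ℕ} (hr : 1 ≤ r) (x : Fin n → K) (hx : ∀ i, x i ≠ 0)
    (y : Fin m → K) (lam : YoungDiagram) (hlen : lam.colLen 0 ≤ n)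
    (hlam : m + r ≤ lam.rowLen (n - 1) + 1) :
    superPowerSum r x y * spo lam x y =
      ∑ eta ∈ addStrip r lam, (-1) ^ height eta lam * spo eta x y +
        ∑ xi ∈ removeStrip r lam, (-1) ^ height lam xi * spo xi x y := by
  have hn : lam.rowLen n = 0 := colLen_le_iff.1 hlen
  have hN : lam.rowLen (n + r) = 0 := rowLen_eq_zero_of_le hn (by omega)
  have hadd : ∀ eta ∈ addStrip r lam, eta.rowLen (n + r) = 0 := by
    intro eta heta
    obtain ⟨p, q, h⟩ := (mem_addStrip.1 heta).exists_stripRows hr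
    exact h.rowLen_eq_zero hN (h.last_row_lt hn)
  have hrem : ∀ xi ∈ removeStrip r lam, xi.rowLen (n + r) = 0 := by
    intro xi hxi
    have := le_iff_rowLen.1 (mem_removeStrip.1 hxi).1 (n + r)
    omega
  -- Since λ_j ≥ λ_{n-1} and `j ≤ n - 1`, the bound in the last of the first `n` rows propagates: m
  -- + r - 1 - (n - 1) = m + r - n.
  have hbeta : ∀ j < n, (m : ℤ) + r - n ≤ beta lam j := by
    intro j hj
    have := lam.rowLen_anti j (n - 1) (by omega)
    simp only [beta]
    omega
  rw [spo_eq_alternant r lam x y hN,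
    Finset.sum_congr rfl fun eta heta => by rw [spo_eq_alternant r eta x y (hadd eta heta)],
    Finset.sum_congr (s₁ := removeStrip r lam) rfl fun xi hxi => by
      rw [spo_eq_alternant r xi x y (hrem xi hxi)]]
  -- All terms share the Weyl denominator, so the identity reduces to one between numerators.
  simp only [← mul_div_assoc, ← Finset.sum_div]
  rw [← add_div, ← sum_alternant_add _ hr lam hn le_rfl,
    ← sum_alternant_sub _ hr lam hN fun i => twist_eq_zero_of_le (baseFun_of_le x i) y]
  obtain ⟨r, rfl⟩ : ∃ s, r = s + 1 := ⟨r - 1, by omega⟩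
  rw [sum_alternant_shift x hx y lam hn hbeta]

end

end OrthoSymplectic

/-! ### Specialisation to independent indeterminates -/

theorem corollary4p6 (n m r : ℕ) (hn : 1 ≤ n) (hr : 1 ≤ r) (lam : YoungDiagram)
    (hlen : lam.colLen 0 ≤ n) (hlam : m + r ≤ lam.rowLen (n - 1) + 1) :
    OrthoSymplectic.superPowerSum r (OrthoSymplectic.xVar n m) (OrthoSymplectic.yVar n m) *
        OrthoSymplectic.spo lam (OrthoSymplectic.xVar n m) (OrthoSymplectic.yVar n m) =
      ∑ eta ∈ OrthoSymplectic.addStrip r lam,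
          (-1) ^ OrthoSymplectic.height eta lam *
            OrthoSymplectic.spo eta (OrthoSymplectic.xVar n m) (OrthoSymplectic.yVar n m) +
        ∑ xi ∈ OrthoSymplectic.removeStrip r lam,
          (-1) ^ OrthoSymplectic.height lam xi *
            OrthoSymplectic.spo xi (OrthoSymplectic.xVar n m) (OrthoSymplectic.yVar n m) := by
  refine OrthoSymplectic.superPowerSum_mul_spo hr _ (fun i => ?_) _ lam hlen hlam
  rw [OrthoSymplectic.xVar, Ne, FaithfulSMul.algebraMap_eq_zero_iff]
  exact MvPolynomial.X_ne_zero _
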